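/- Let $B,x_0,\dot x_0\in\mathbb R^3$ and $T>0$, and let $\tilde B$ be the skew-symmetric $3\times 3$ matrix with $\tilde B v=v\times B$ for all $v\in\mathbb R^3$. For $\epsilon\in(0,1]$ put $M=\tilde B/\epsilon$ and let $x(t)$, $v(t)=\dot x(t)$, $t\in[0,T]$, be a solution of $$\ddot x(t)=\dot x(t)\times\frac{B}{\epsilon}+F(x(t)),\qquad x(0)=x_0,\quad \dot x(0)=\dot x_0 .$$ Put $\varphi_0(Z)=e^{Z}$ and $\varphi_1(Z)=\int_0^1 e^{(1-\sigma)Z}\,d\sigma$. For a step size $h>0$ and $t_n=nh$ consider the continuous-stage adapted exponential method, started from the initial data $(x_0,v_0)$ with $v_0=\dot x_0$, $$X^n_\tau=x_n+\tau h\varphi_1(\tau hM)v_n+h^2\int_0^1\alpha_{\tau\sigma}(hM)F(X^n_\sigma)\,d\sigma,\qquad \tau\in[0,1],$$ $$x_{n+1}=x_n+h\varphi_1(hM)v_n+h^2\int_0^1\beta_\tau(hM)F(X^n_\tau)\,d\tau,\qquad v_{n+1}=\varphi_0(hM)v_n+h\int_0^1\gamma_\tau(hM)F(X^n_\tau)\,d\tau,$$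 with continuous stages $X^n:[0,1]\to\mathbb R^3$ and with $\beta_\tau(Z)=(1-\tau)\varphi_1((1-\tau)Z)$, $\gamma_\tau(Z)=\varphi_0((1-\tau)Z)$ and * (second-order method) $\alpha_{\tau\sigma}(Z)=\frac{\tau-\sigma}{2}\varphi_1((\tau-\sigma)Z)$, * (fourth-order method) $\alpha_{\tau\sigma}(Z)=\left(\frac16+\frac{\tau-\sigma}{2}\right)\varphi_1((\tau-\sigma)Z)$. Let $F:\mathbb R^3\to\mathbb R^3$ satisfy the following conditions on a strip of radius $R\in(0,\infty]$ along the exact solution, that is, on every open ball of radius $R$ about a point $x(t)$, $t\in[0,T]$: $F$ is Lipschitz continuous with constant $L$ and is $C^k$ with $\left\|\frac{d^s}{dx^s}F\right\|\le D$ for $s=1,\dots,k$, where $k=2$ for the second-order method and $k=4$ for the fourth-order method. Here $L$, $D$ and $R$ do not depend on $\epsilon$; $R=\infty$ means that the conditions hold on all of $\mathbb R^3$. Then for every $\widehat C>0$ there are constants $h_0>0$ and $C>0$, independent of $\epsilon$, $h$ and $n$ (they depend only on $\widehat C,L,D,R,T$, on $B,x_0,\dot x_0$ and on an upper bound $F_0$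 of $\|F(x_0)\|$), such that for all $\epsilon\in(0,1]$ and all $0<h\le h_0$ with $h\le\widehat C\epsilon$ each of the two methods has, for all steps with $(n+1)h\le T$, a numerical solution whose stages lie in the strip, $\|X^n_\tau-x(t_n+\tau h)\|<R$, and every such numerical solution satisfies, for all $n\ge 0$ with $nh\le T$, $$\text{second-order method:}\quad \|x(t_n)-x_n\|\le Ch^2,\qquad \|v(t_n)-v_n\|\le Ch^2/\epsilon,$$ $$\text{fourth-order method:}\quad \|x(t_n)-x_n\|\le Ch^4/\epsilon^2,\qquad \|v(t_n)-v_n\|\le Ch^4/\epsilon^3 .$$ In particular, the position error of the second-order method is uniform in $\epsilon$. -/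

import Mathlib

open scoped NNReal ENNReal Matrix

namespace CPD

/-- Euclidean space `ℝ³`. -/
abbrev E3 : Type := EuclideanSpace ℝ (Fin 3)

/-- The cross product `u × w` on Euclidean `ℝ³`. -/
noncomputable def cross (u w : E3) : E3 :=
  WithLp.toLp 2 (crossProduct (WithLp.ofLp u) (WithLp.ofLp w))

/-- The skew-symmetric matrix `B̃`, characterised by `B̃ v = v × B`. -/
def skewMatrix (B : E3) : Matrix (Fin 3) (Fin 3) ℝ :=
  !![0, B 2, -B 1; -B 2, 0, B 0; B 1, -B 0, 0]

/-- The matrix `B̃`, as an operator on Euclidean `ℝ³`. -/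
noncomputable def skewOp (B : E3) : E3 →L[ℝ] E3 :=
  Matrix.toEuclideanCLM (𝕜 := ℝ) (skewMatrix B)

theorem skewOp_apply (B v : E3) : skewOp B v = cross v B := by
  ext i
  rw [skewOp, Matrix.ofLp_toEuclideanCLM]
  fin_cases i <;>
    simp [skewMatrix, cross, cross_apply, Matrix.mulVec, dotProduct, Fin.sum_univ_three] <;> ring

/-- The `φ`-functions: `φ₀(Z) = exp Z` and, for `k ≥ 1`,
`φ_k(Z) = ∫₀¹ exp((1 - σ) Z) σ^(k-1) / (k-1)! dσ`. -/
noncomputable def phi {E : Type*} [NormedAddCommGroup E] [NormedSpace ℝ E] :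
    ℕ → (E →L[ℝ] E) → (E →L[ℝ] E)
  | 0, Z => NormedSpace.exp Z
  | k + 1, Z => ∫ σ in (0 : ℝ)..1,
      (σ ^ k / (Nat.factorial k : ℝ)) • NormedSpace.exp ((1 - σ) • Z)

/-- `(x, v)` is an exact solution on `[0, T]` of
`x'' = x' × B / ε + F(x)`, `x(0) = x₀`, `x'(0) = v₀`, with `v = x'`. -/
structure IsExactSolution (F : E3 → E3) (B : E3) (ε T : ℝ) (x₀ v₀ : E3) (x v : ℝ → E3) :
    Prop where
  init_x : x 0 = x₀
  init_v : v 0 = v₀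
  deriv_x : ∀ t ∈ Set.Icc 0 T, HasDerivWithinAt x (v t) (Set.Icc 0 T) t
  deriv_v : ∀ t ∈ Set.Icc 0 T,
    HasDerivWithinAt v (cross (v t) (ε⁻¹ • B) + F (x t)) (Set.Icc 0 T) t

/-- The coefficient functions `α_{τσ}(Z)`, `β_τ(Z)`, `γ_τ(Z)` of a continuous-stage adapted
exponential method. -/
structure Coeffs (E : Type*) [NormedAddCommGroup E] [NormedSpace ℝ E] where
  α : ℝ → ℝ → (E →L[ℝ] E) → (E →L[ℝ] E)
  β : ℝ → (E →L[ℝ] E) → (E →L[ℝ] E)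
  γ : ℝ → (E →L[ℝ] E) → (E →L[ℝ] E)

/-- One step `(x, v) ↦ (x', v')` of the continuous-stage adapted exponential method with
coefficients `c`, step size `h` and operator `M` (which is `B̃ / ε` in the application); `X` is the (continuous) stage function, which
is given implicitly. -/
structure IsStep {E : Type*} [NormedAddCommGroup E] [NormedSpace ℝ E]
    (c : Coeffs E) (F : E → E) (M : E →L[ℝ] E) (h : ℝ)
    (x v : E) (X : ℝ → E) (x' v' : E) : Prop where
  cont : ContinuousOn X (Set.Icc 0 1)
  stage : ∀ τ ∈ Set.Icc (0 : ℝ) 1,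
    X τ = x + (τ * h) • phi 1 ((τ * h) • M) v
      + h ^ 2 • ∫ σ in (0 : ℝ)..1, c.α τ σ (h • M) (F (X σ))
  step_x : x' = x + h • phi 1 (h • M) v
      + h ^ 2 • ∫ τ in (0 : ℝ)..1, c.β τ (h • M) (F (X τ))
  step_v : v' = phi 0 (h • M) v
      + h • ∫ τ in (0 : ℝ)..1, c.γ τ (h • M) (F (X τ))

/-- `xn, vn` (with stage functions `X n`) is a numerical solution on `[0, T]` with step size `h`:
all steps that end at a time `(n + 1) h ≤ T` are steps of the method. -/
structure IsNumericalSolution {E : Type*} [NormedAddCommGroup E] [NormedSpace ℝ E]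
    (c : Coeffs E) (F : E → E) (M : E →L[ℝ] E) (T h : ℝ) (x₀ v₀ : E)
    (xn vn : ℕ → E) (X : ℕ → ℝ → E) : Prop where
  init_x : xn 0 = x₀
  init_v : vn 0 = v₀
  step : ∀ n : ℕ, ((n : ℝ) + 1) * h ≤ T →
    IsStep c F M h (xn n) (vn n) (X n) (xn (n + 1)) (vn (n + 1))

/-- The second-order method. -/
noncomputable def secondOrder {E : Type*} [NormedAddCommGroup E] [NormedSpace ℝ E] :
    Coeffs E where
  α τ σ Z := ((τ - σ) / 2) • phi 1 ((τ - σ) • Z)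
  β τ Z := (1 - τ) • phi 1 ((1 - τ) • Z)
  γ τ Z := phi 0 ((1 - τ) • Z)

/-- The fourth-order method. -/
noncomputable def fourthOrder {E : Type*} [NormedAddCommGroup E] [NormedSpace ℝ E] :
    Coeffs E where
  α τ σ Z := (1 / 6 + (τ - σ) / 2) • phi 1 ((τ - σ) • Z)
  β τ Z := (1 - τ) • phi 1 ((1 - τ) • Z)
  γ τ Z := phi 0 ((1 - τ) • Z)

/-- `F` is locally Lipschitz with constant `L`, and `k` times continuously differentiable with
derivatives of order `1, …, k` bounded by `D`, in the strip of radius `R` along the curve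
`x` on `[0, T]`, i.e. on every open ball `ball (x t) R`. The radius may be `∞`, in which case
these are global conditions on `F`. -/
structure RegularAlong {E : Type*} [NormedAddCommGroup E] [NormedSpace ℝ E]
    (F : E → E) (k : ℕ) (L : ℝ≥0) (D : ℝ) (R : ℝ≥0∞) (T : ℝ) (x : ℝ → E) : Prop where
  lipschitz : ∀ t ∈ Set.Icc 0 T, LipschitzOnWith L F (Metric.eball (x t) R)
  contDiff : ∀ t ∈ Set.Icc 0 T, ContDiffOn ℝ k F (Metric.eball (x t) R)
  bound : ∀ t ∈ Set.Icc 0 T, ∀ y ∈ Metric.eball (x t) R, ∀ s ∈ Finset.Icc 1 k,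
    ‖iteratedFDeriv ℝ s F y‖ ≤ D

/-- The stages of a numerical solution on `[0, T]` stay in the strip of radius `R` along the exact
solution: `‖X n τ - x((n + τ) h)‖ < R`. -/
def StagesInStrip {E : Type*} [NormedAddCommGroup E] [NormedSpace ℝ E]
    (R : ℝ≥0∞) (T h : ℝ) (x : ℝ → E) (X : ℕ → ℝ → E) : Prop :=
  ∀ n : ℕ, ((n : ℝ) + 1) * h ≤ T → ∀ τ ∈ Set.Icc (0 : ℝ) 1,
    X n τ ∈ Metric.eball (x (((n : ℝ) + τ) * h)) R

end CPD

/-! Since `skewOp B` is skew-adjoint, `exp (s M)` is unitary for every `ε`; this is the only source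
of uniformity in `ε`. Its averages `φ₁` are contractions too, and so is the kernel `psi Z s` for
`|s| ≤ 1`.

On one step, with time rescaled by `h` and `Z = hM`, the exact solution `(y, w)` satisfies the
variation-of-constants formula, whose kernels at the endpoint are exactly `β` and `γ`. Hence the
updates make no error of their own: besides the incoming errors, only integrals of `F(X) - F(y)`
remain (`IsStep.x_sub`, `IsStep.v_sub`). The stages do have a defect, since `α` integrates over
`[0,1]` instead of `[0,τ]`; it enters with the factor `h²`.

Bounding the defect crudely gives stages within `O(h²)` of `y`, up to incoming errors, and a local
error `O(h³)`, for any admissible coefficients. The recursion `a (m+1) ≤ (1 + K h) a m + K h δ` then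
yields `O(h²)` for position and velocity together, uniformly in `ε`
(`IsBoundedSolution.norm_error_le`). This is stronger than the stated velocity bound. The same
estimate keeps the next stage problem inside the strip, where a contraction argument solves it
(`exists_isStep`), so existence and error control advance together.

For the fourth-order method put `η = h/ε`, so that `‖Z‖ = O(η)` and `h ≤ η`. Linearising, `F(X) -
F(y)` is `h² F'(y) D` up to `O(h⁴)` and incoming errors, with `D` the stage defect. Expanding
`exp((1-τ)Z) F'(y) D` to first order in `η`, the terms of order 0 and 1 have zero mean on `[0,1]`:
these are the order conditions. What remains in the velocity is `h · h² · η²`. The position carries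
another factor `h ≤ η`, so there one order of cancellation suffices. Summation gives `h² η² = h⁴/ε²`
for both components.

All constants rest on a bound for `v` and `F ∘ x` independent of `ε`
(`RegularAlong.isBoundedSolution`), obtained by undoing the rotation in the velocity and applying
Gronwall. -/

namespace CPD

/-! ### The functions `φ₀`, `φ₁` and the kernel `psi` -/

section PhiFunctions

variable {E : Type*} [NormedAddCommGroup E] [NormedSpace ℝ E]

/-- `ψ(s) = s φ₁(s Z)`, a primitive of `s ↦ exp (s Z)`. -/
noncomputable def psi (Z : E →L[ℝ] E) (s : ℝ) : E →L[ℝ] E := s • phi 1 (s • Z)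

theorem phi_zero (Z : E →L[ℝ] E) : phi 0 Z = NormedSpace.exp Z := rfl

theorem phi_one (Z : E →L[ℝ] E) :
    phi 1 Z = ∫ σ in (0 : ℝ)..1, NormedSpace.exp ((1 - σ) • Z) := by
  simp [phi]

theorem phi_one_smul (Z : E →L[ℝ] E) (s : ℝ) :
    phi 1 (s • Z) = ∫ σ in (0 : ℝ)..1, NormedSpace.exp (((1 - σ) * s) • Z) := by
  simp [phi_one, smul_smul]

theorem psi_zero (Z : E →L[ℝ] E) : psi Z 0 = 0 := by simp [psi]

variable [CompleteSpace E]

theorem hasDerivAt_exp_smul (Z : E →L[ℝ] E) (s : ℝ) :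
    HasDerivAt (fun u : ℝ => NormedSpace.exp (u • Z)) (NormedSpace.exp (s • Z) * Z) s :=
  hasDerivAt_exp_smul_const Z s

theorem continuous_exp_smul (Z : E →L[ℝ] E) :
    Continuous (fun u : ℝ => NormedSpace.exp (u • Z)) :=
  continuous_iff_continuousAt.2 fun s => (hasDerivAt_exp_smul Z s).continuousAt

theorem continuous_phi_one_smul (Z : E →L[ℝ] E) : Continuous (fun s : ℝ => phi 1 (s • Z)) := by
  simp_rw [phi_one_smul]
  apply intervalIntegral.continuous_parametric_intervalIntegral_of_continuous'
  exact (continuous_exp_smul Z).comp (by fun_prop : Continuous fun p : ℝ × ℝ => (1 - p.2) * p.1)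

theorem continuous_psi (Z : E →L[ℝ] E) : Continuous (psi Z) :=
  continuous_id.smul (continuous_phi_one_smul Z)

omit [CompleteSpace E] in
theorem psi_eq_integral (Z : E →L[ℝ] E) (s : ℝ) :
    psi Z s = ∫ u in (0 : ℝ)..s, NormedSpace.exp (u • Z) := by
  have h := intervalIntegral.smul_integral_comp_sub_mul (a := 0) (b := 1)
    (fun u : ℝ => NormedSpace.exp (u • Z)) s s
  rw [psi, phi_one_smul]
  simp only [mul_one, sub_self, mul_zero, sub_zero] at h
  rw [← h]
  congr 1
  apply intervalIntegral.integral_congr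
  intro u _
  simp only
  congr 2
  ring

theorem hasDerivAt_psi (Z : E →L[ℝ] E) (s : ℝ) :
    HasDerivAt (psi Z) (NormedSpace.exp (s • Z)) s := by
  have h := (continuous_exp_smul Z).integral_hasStrictDerivAt 0 s
  have e : psi Z = fun s => ∫ u in (0 : ℝ)..s, NormedSpace.exp (u • Z) :=
    funext (psi_eq_integral Z)
  rw [e]
  exact h.hasDerivAt

/-- Both sides have the same derivative in `s` and agree at `0`. In this form no inverse of `Z` is
needed, which matters because a skew operator on `ℝ³` is singular. -/
theorem psi_mul (Z : E →L[ℝ] E) (s : ℝ) : psi Z s * Z = NormedSpace.exp (s • Z) - 1 := by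
  have hd : ∀ u, HasDerivAt (fun u => psi Z u * Z - NormedSpace.exp (u • Z)) 0 u := fun u => by
    simpa using ((hasDerivAt_psi Z u).mul_const Z).fun_sub (hasDerivAt_exp_smul Z u)
  have h := is_const_of_deriv_eq_zero (fun u => (hd u).differentiableAt)
    (fun u => (hd u).deriv) s 0
  simp only [psi_zero, zero_mul, zero_smul, NormedSpace.exp_zero, zero_sub] at h
  rw [sub_eq_iff_eq_add] at h
  rw [h]; abel

/-! ### Bounds when the exponentials are contractions -/

section Contractive

variable {Z : E →L[ℝ] E} (hZ : ∀ s : ℝ, ‖NormedSpace.exp (s • Z)‖ ≤ 1)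
include hZ

omit [CompleteSpace E] in
theorem norm_phi_one_smul_le (s : ℝ) : ‖phi 1 (s • Z)‖ ≤ 1 := by
  rw [phi_one_smul]
  simpa using intervalIntegral.norm_integral_le_of_norm_le_const (a := 0) (b := 1)
    (fun σ _ => hZ ((1 - σ) * s))

omit [CompleteSpace E] in
theorem norm_psi_le (s : ℝ) : ‖psi Z s‖ ≤ |s| := by
  rw [psi, norm_smul, Real.norm_eq_abs]
  exact mul_le_of_le_one_right (abs_nonneg s) (norm_phi_one_smul_le hZ s)

theorem norm_exp_smul_sub_one_le (s : ℝ) : ‖NormedSpace.exp (s • Z) - 1‖ ≤ |s| * ‖Z‖ := by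
  rw [← psi_mul]
  exact (norm_mul_le _ _).trans (mul_le_mul_of_nonneg_right (norm_psi_le hZ s) (norm_nonneg _))

/-- The derivative in `u` is `(exp (u Z) - 1) Z`, of norm at most `‖Z‖²` on `[-1,1]`. Contractivity
replaces the usual factor `exp ‖Z‖`. -/
theorem norm_exp_smul_sub_linear_le {s : ℝ} (hs : |s| ≤ 1) :
    ‖NormedSpace.exp (s • Z) - 1 - s • Z‖ ≤ ‖Z‖ ^ 2 := by
  have hd : ∀ u : ℝ, HasDerivAt (fun u : ℝ => NormedSpace.exp (u • Z) - 1 - u • Z)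
      ((NormedSpace.exp (u • Z) - 1) * Z) u := fun u => by
    have h := ((hasDerivAt_exp_smul Z u).sub_const 1).fun_sub ((hasDerivAt_id' u).smul_const Z)
    simpa [sub_mul] using h
  have h := (convex_closedBall (0 : ℝ) 1).norm_image_sub_le_of_norm_hasDerivWithin_le
    (f := fun u : ℝ => NormedSpace.exp (u • Z) - 1 - u • Z)
    (f' := fun u : ℝ => (NormedSpace.exp (u • Z) - 1) * Z) (C := ‖Z‖ ^ 2) (x := 0) (y := s)
    (fun u _ => (hd u).hasDerivWithinAt) (fun u hu => by
      have hu' : |u| ≤ 1 := by simpa using hu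
      calc _ ≤ ‖NormedSpace.exp (u • Z) - 1‖ * ‖Z‖ := norm_mul_le _ _
        _ ≤ (|u| * ‖Z‖) * ‖Z‖ := by gcongr; exact norm_exp_smul_sub_one_le hZ u
        _ ≤ (1 * ‖Z‖) * ‖Z‖ := by gcongr
        _ = ‖Z‖ ^ 2 := by ring)
    (by simp) (by simpa using hs)
  simp only [zero_smul, NormedSpace.exp_zero, sub_self, sub_zero, Real.norm_eq_abs] at h
  exact h.trans (mul_le_of_le_one_right (by positivity) hs)

theorem norm_phi_one_smul_sub_linear_le {s : ℝ} (hs : |s| ≤ 1) :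
    ‖phi 1 (s • Z) - 1 - (s / 2) • Z‖ ≤ ‖Z‖ ^ 2 := by
  have hc : Continuous fun σ : ℝ => NormedSpace.exp (((1 - σ) * s) • Z) :=
    (continuous_exp_smul Z).comp (by fun_prop : Continuous fun σ : ℝ => (1 - σ) * s)
  have e : phi 1 (s • Z) - 1 - (s / 2) • Z
      = ∫ σ in (0 : ℝ)..1,
        (NormedSpace.exp (((1 - σ) * s) • Z) - 1 - ((1 - σ) * s) • Z) := by
    have h1 : IntervalIntegrable (fun σ : ℝ => NormedSpace.exp (((1 - σ) * s) • Z) - 1)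
        MeasureTheory.volume 0 1 := (hc.sub continuous_const).intervalIntegrable _ _
    have h2 : IntervalIntegrable (fun σ : ℝ => ((1 - σ) * s) • Z) MeasureTheory.volume 0 1 :=
      (by fun_prop : Continuous fun σ : ℝ => ((1 - σ) * s) • Z).intervalIntegrable _ _
    rw [intervalIntegral.integral_sub h1 h2,
      intervalIntegral.integral_sub (hc.intervalIntegrable _ _)
      (continuous_const.intervalIntegrable _ _), ← phi_one_smul,
      intervalIntegral.integral_smul_const, intervalIntegral.integral_mul_const]
    have : (∫ x in (0 : ℝ)..1, (1 - x)) = 1 / 2 := by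
      rw [intervalIntegral.integral_sub (by simp) (by simp)]
      simp; norm_num
    rw [this]
    simp
    ring_nf
  rw [e]
  have := intervalIntegral.norm_integral_le_of_norm_le_const (a := (0 : ℝ)) (b := 1)
    (f := fun σ : ℝ => NormedSpace.exp (((1 - σ) * s) • Z) - 1 - ((1 - σ) * s) • Z)
    (C := ‖Z‖ ^ 2) (fun σ hσ => by
      rw [Set.uIoc_of_le zero_le_one] at hσ
      apply norm_exp_smul_sub_linear_le hZ
      rw [abs_mul]
      have h1 : |1 - σ| ≤ 1 := abs_le.2 ⟨by linarith [hσ.2], by linarith [hσ.1]⟩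
      exact mul_le_one₀ h1 (abs_nonneg _) hs)
  simpa using this

end Contractive

end PhiFunctions

/-! ### Variation of constants on one rescaled step -/

section LocalSolutions

variable {E : Type*} [NormedAddCommGroup E] [NormedSpace ℝ E]

/-- `(y, w)` solves, on the unit interval, the system `y' = h w`, `w' = Z w + h F(y)` obtained
from `x' = v`, `v' = M v + F(x)` by rescaling time with `h`; here `Z = h M`. -/
structure IsLocalSolution (F : E → E) (Z : E →L[ℝ] E) (h : ℝ) (y w : ℝ → E) : Prop where
  deriv_y : ∀ τ ∈ Set.Icc (0 : ℝ) 1, HasDerivWithinAt y (h • w τ) (Set.Icc 0 1) τ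
  deriv_w : ∀ τ ∈ Set.Icc (0 : ℝ) 1,
    HasDerivWithinAt w (Z (w τ) + h • F (y τ)) (Set.Icc 0 1) τ
  cont : ContinuousOn (fun τ => F (y τ)) (Set.Icc 0 1)

variable {F : E → E} {Z M : E →L[ℝ] E} {h : ℝ} {y w : ℝ → E}

omit [NormedSpace ℝ E] in
theorem intervalIntegrable_of_continuousOn_Icc {f : ℝ → E} {a b : ℝ} (ha : 0 ≤ a) (hab : a ≤ b)
    (hb : b ≤ 1) (hf : ContinuousOn f (Set.Icc 0 1)) :
    IntervalIntegrable f MeasureTheory.volume a b :=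
  (hf.mono (by rw [Set.uIcc_of_le hab]; exact Set.Icc_subset_Icc ha hb)).intervalIntegrable

theorem norm_integral_unit_le {f : ℝ → E} {K : ℝ}
    (hf : ∀ τ ∈ Set.Icc (0 : ℝ) 1, ‖f τ‖ ≤ K) : ‖∫ τ in (0 : ℝ)..1, f τ‖ ≤ K := by
  simpa using intervalIntegral.norm_integral_le_of_norm_le_const (a := (0 : ℝ)) (b := 1)
    (f := f) (C := K) fun τ hτ => hf τ (by
      rw [Set.uIoc_of_le zero_le_one] at hτ
      exact Set.Ioc_subset_Icc_self hτ)

theorem IsLocalSolution.continuousOn_y (hs : IsLocalSolution F Z h y w) :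
    ContinuousOn y (Set.Icc 0 1) := fun τ hτ => (hs.deriv_y τ hτ).continuousWithinAt

theorem IsLocalSolution.continuousOn_w (hs : IsLocalSolution F Z h y w) :
    ContinuousOn w (Set.Icc 0 1) := fun τ hτ => (hs.deriv_w τ hτ).continuousWithinAt

variable [CompleteSpace E]

theorem IsLocalSolution.w_eq (hs : IsLocalSolution F Z h y w) {τ : ℝ}
    (hτ : τ ∈ Set.Icc (0 : ℝ) 1) :
    w τ = NormedSpace.exp (τ • Z) (w 0)
      + h • ∫ σ in (0 : ℝ)..τ, NormedSpace.exp ((τ - σ) • Z) (F (y σ)) := by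
  have hsub : Set.Icc 0 τ ⊆ Set.Icc (0 : ℝ) 1 := Set.Icc_subset_Icc le_rfl hτ.2
  have hce : Continuous fun σ : ℝ => NormedSpace.exp ((τ - σ) • Z) :=
    (continuous_exp_smul Z).comp (by fun_prop : Continuous fun σ : ℝ => τ - σ)
  have hint := intervalIntegral.integral_eq_sub_of_hasDerivAt_of_le hτ.1
    (f := fun σ => NormedSpace.exp ((τ - σ) • Z) (w σ))
    (f' := fun σ => h • NormedSpace.exp ((τ - σ) • Z) (F (y σ)))
    (hce.continuousOn.clm_apply (hs.continuousOn_w.mono hsub))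
    (fun σ hσ => by
      have hσ1 : σ ∈ Set.Icc (0 : ℝ) 1 := hsub (Set.Ioo_subset_Icc_self hσ)
      have h1 : HasDerivAt (fun σ : ℝ => NormedSpace.exp ((τ - σ) • Z))
          ((-1 : ℝ) • (NormedSpace.exp ((τ - σ) • Z) * Z)) σ :=
        (hasDerivAt_exp_smul Z (τ - σ)).scomp σ ((hasDerivAt_id' σ).const_sub τ)
      have h2 := (hs.deriv_w σ hσ1).hasDerivAt
        (Icc_mem_nhds hσ.1 (hσ.2.trans_le hτ.2))
      convert h1.clm_apply h2 using 1
      simp)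
    (intervalIntegrable_of_continuousOn_Icc le_rfl hτ.1 hτ.2
      ((hce.continuousOn.clm_apply hs.cont).const_smul h))
  rw [intervalIntegral.integral_smul] at hint
  rw [hint]
  simp

/-- Differentiate `y σ + h psi (τ - σ) (w σ)` in `σ`: by `psi_mul` the term `psi (Z w)` is `exp w -
w`, so everything except the force cancels. -/
theorem IsLocalSolution.y_eq (hs : IsLocalSolution F Z h y w) {τ : ℝ}
    (hτ : τ ∈ Set.Icc (0 : ℝ) 1) :
    y τ = y 0 + h • psi Z τ (w 0)
      + h ^ 2 • ∫ σ in (0 : ℝ)..τ, psi Z (τ - σ) (F (y σ)) := by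
  have hsub : Set.Icc 0 τ ⊆ Set.Icc (0 : ℝ) 1 := Set.Icc_subset_Icc le_rfl hτ.2
  have hce : Continuous fun σ : ℝ => psi Z (τ - σ) :=
    (continuous_psi Z).comp (by fun_prop : Continuous fun σ : ℝ => τ - σ)
  have hint := intervalIntegral.integral_eq_sub_of_hasDerivAt_of_le hτ.1
    (f := fun σ => y σ + h • psi Z (τ - σ) (w σ))
    (f' := fun σ => h ^ 2 • psi Z (τ - σ) (F (y σ)))
    ((hs.continuousOn_y.mono hsub).add
      ((hce.continuousOn.clm_apply (hs.continuousOn_w.mono hsub)).const_smul h))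
    (fun σ hσ => by
      have hσ1 : σ ∈ Set.Icc (0 : ℝ) 1 := hsub (Set.Ioo_subset_Icc_self hσ)
      have hn := Icc_mem_nhds hσ.1 (hσ.2.trans_le hτ.2)
      have h1 : HasDerivAt (fun σ : ℝ => psi Z (τ - σ))
          ((-1 : ℝ) • NormedSpace.exp ((τ - σ) • Z)) σ :=
        (hasDerivAt_psi Z (τ - σ)).scomp σ ((hasDerivAt_id' σ).const_sub τ)
      have h2 := (hs.deriv_w σ hσ1).hasDerivAt hn
      have h3 := ((hs.deriv_y σ hσ1).hasDerivAt hn).add ((h1.clm_apply h2).const_smul h)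
      have h4 : psi Z (τ - σ) (Z (w σ)) = NormedSpace.exp ((τ - σ) • Z) (w σ) - w σ := by
        have := congrArg (fun A : E →L[ℝ] E => A (w σ)) (psi_mul Z (τ - σ))
        simpa using this
      refine h3.congr_deriv ?_
      rw [map_add, map_smul, h4, neg_one_smul, neg_apply]
      module)
    (intervalIntegrable_of_continuousOn_Icc le_rfl hτ.1 hτ.2
      ((hce.continuousOn.clm_apply hs.cont).const_smul _))
  rw [intervalIntegral.integral_smul] at hint
  rw [hint]
  simp [psi_zero]

end LocalSolutions

/-! ### Error equations of one step -/

section OneStep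

variable {E : Type*} [NormedAddCommGroup E] [NormedSpace ℝ E]

/-- The coefficients are continuous, bounded in the stages, and exact in the update. -/
structure Coeffs.IsAdmissible (c : Coeffs E) (Z : E →L[ℝ] E) : Prop where
  cont_α : Continuous fun p : ℝ × ℝ => c.α p.1 p.2 Z
  norm_α : ∀ τ ∈ Set.Icc (0 : ℝ) 1, ∀ σ ∈ Set.Icc (0 : ℝ) 1, ‖c.α τ σ Z‖ ≤ 1
  β_eq : ∀ τ, c.β τ Z = psi Z (1 - τ)
  γ_eq : ∀ τ, c.γ τ Z = NormedSpace.exp ((1 - τ) • Z)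

/-- The defect of the stage coefficients with respect to the variation-of-constants formula. -/
noncomputable def stageDefect (c : Coeffs E) (F : E → E) (Z : E →L[ℝ] E) (y : ℝ → E)
    (τ : ℝ) : E :=
  (∫ σ in (0 : ℝ)..1, c.α τ σ Z (F (y σ))) - ∫ σ in (0 : ℝ)..τ, psi Z (τ - σ) (F (y σ))

variable [CompleteSpace E] {c : Coeffs E} {F : E → E} {Z M : E →L[ℝ] E} {h : ℝ}

theorem secondOrder_isAdmissible (hZ : ∀ s : ℝ, ‖NormedSpace.exp (s • Z)‖ ≤ 1) :
    (secondOrder : Coeffs E).IsAdmissible Z where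
  cont_α := by
    have h1 : Continuous fun p : ℝ × ℝ => phi 1 ((p.1 - p.2) • Z) :=
      (continuous_phi_one_smul Z).comp (by fun_prop : Continuous fun p : ℝ × ℝ => p.1 - p.2)
    exact (by fun_prop : Continuous fun p : ℝ × ℝ => (p.1 - p.2) / 2).smul h1
  norm_α τ hτ σ hσ := by
    simp only [secondOrder, norm_smul, Real.norm_eq_abs]
    refine mul_le_one₀ (abs_le.2 ⟨?_, ?_⟩) (norm_nonneg _) (norm_phi_one_smul_le hZ _)
    · linarith [hτ.1, hσ.2]
    · linarith [hτ.2, hσ.1]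
  β_eq _ := rfl
  γ_eq _ := rfl

theorem fourthOrder_isAdmissible (hZ : ∀ s : ℝ, ‖NormedSpace.exp (s • Z)‖ ≤ 1) :
    (fourthOrder : Coeffs E).IsAdmissible Z where
  cont_α := by
    have h1 : Continuous fun p : ℝ × ℝ => phi 1 ((p.1 - p.2) • Z) :=
      (continuous_phi_one_smul Z).comp (by fun_prop : Continuous fun p : ℝ × ℝ => p.1 - p.2)
    exact (by fun_prop : Continuous fun p : ℝ × ℝ => 1 / 6 + (p.1 - p.2) / 2).smul h1
  norm_α τ hτ σ hσ := by
    simp only [fourthOrder, norm_smul, Real.norm_eq_abs]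
    refine mul_le_one₀ (abs_le.2 ⟨?_, ?_⟩) (norm_nonneg _) (norm_phi_one_smul_le hZ _)
    · linarith [hτ.1, hσ.2]
    · linarith [hτ.2, hσ.1]
  β_eq _ := rfl
  γ_eq _ := rfl

omit [NormedSpace ℝ E] [CompleteSpace E] in
theorem continuousOn_comp_of_strip {L : ℝ≥0} {R : ℝ≥0∞} {y X : ℝ → E}
    (hL : ∀ τ ∈ Set.Icc (0 : ℝ) 1, LipschitzOnWith L F (Metric.eball (y τ) R))
    (hX : ∀ τ ∈ Set.Icc (0 : ℝ) 1, X τ ∈ Metric.eball (y τ) R)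
    (hXc : ContinuousOn X (Set.Icc 0 1)) : ContinuousOn (fun τ => F (X τ)) (Set.Icc 0 1) := by
  intro τ hτ
  have h1 : ContinuousAt F (X τ) :=
    (hL τ hτ).continuousOn.continuousAt (Metric.isOpen_eball.mem_nhds (hX τ hτ))
  exact h1.comp_continuousWithinAt (hXc τ hτ)

omit [NormedSpace ℝ E] [CompleteSpace E] in
theorem norm_sub_le_of_strip {L : ℝ≥0} {R : ℝ≥0∞} (hR : 0 < R) {y X : ℝ → E}
    (hL : ∀ τ ∈ Set.Icc (0 : ℝ) 1, LipschitzOnWith L F (Metric.eball (y τ) R))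
    (hX : ∀ τ ∈ Set.Icc (0 : ℝ) 1, X τ ∈ Metric.eball (y τ) R) {τ : ℝ}
    (hτ : τ ∈ Set.Icc (0 : ℝ) 1) : ‖F (X τ) - F (y τ)‖ ≤ L * ‖X τ - y τ‖ :=
  (hL τ hτ).norm_sub_le (hX τ hτ) (Metric.mem_eball_self hR)

omit [CompleteSpace E] in
theorem Coeffs.IsAdmissible.continuousOn_α (hc : c.IsAdmissible Z) (τ : ℝ) {f : ℝ → E}
    (hf : ContinuousOn f (Set.Icc 0 1)) :
    ContinuousOn (fun σ => c.α τ σ Z (f σ)) (Set.Icc 0 1) :=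
  (hc.cont_α.comp (by fun_prop : Continuous fun σ : ℝ => (τ, σ))).continuousOn.clm_apply hf

omit [CompleteSpace E] in
theorem norm_integral_α_le (hc : c.IsAdmissible Z) {f : ℝ → E} {K τ : ℝ}
    (hτ : τ ∈ Set.Icc (0 : ℝ) 1) (hf : ∀ σ ∈ Set.Icc (0 : ℝ) 1, ‖f σ‖ ≤ K) :
    ‖∫ σ in (0 : ℝ)..1, c.α τ σ Z (f σ)‖ ≤ K := by
  refine norm_integral_unit_le fun σ hσ => ?_
  refine ((c.α τ σ Z).le_opNorm _).trans ?_
  exact (mul_le_of_le_one_left (norm_nonneg _) (hc.norm_α τ hτ σ hσ)).trans (hf σ hσ)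

/-- Both kernels are bounded by one. This crude bound needs no smallness of `Z` and already gives
the second-order rate. -/
theorem norm_stageDefect_le (hZ : ∀ s : ℝ, ‖NormedSpace.exp (s • Z)‖ ≤ 1)
    (hc : c.IsAdmissible Z) {y : ℝ → E} {Γ τ : ℝ} (hτ : τ ∈ Set.Icc (0 : ℝ) 1)
    (hΓ : ∀ σ ∈ Set.Icc (0 : ℝ) 1, ‖F (y σ)‖ ≤ Γ) : ‖stageDefect c F Z y τ‖ ≤ 2 * Γ := by
  have hΓ0 : 0 ≤ Γ := (norm_nonneg _).trans (hΓ τ hτ)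
  have h1 := norm_integral_α_le (f := fun σ => F (y σ)) hc hτ hΓ
  have h2 : ‖∫ σ in (0 : ℝ)..τ, psi Z (τ - σ) (F (y σ))‖ ≤ Γ := by
    have := intervalIntegral.norm_integral_le_of_norm_le_const (a := (0 : ℝ)) (b := τ)
      (f := fun σ => psi Z (τ - σ) (F (y σ))) (C := Γ) fun σ hσ => by
        rw [Set.uIoc_of_le hτ.1] at hσ
        have h3 : ‖psi Z (τ - σ)‖ ≤ 1 := (norm_psi_le hZ _).trans
          (abs_le.2 ⟨by linarith [hσ.2], by linarith [hσ.1, hτ.2]⟩)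
        refine ((psi Z (τ - σ)).le_opNorm _).trans ?_
        exact (mul_le_of_le_one_left (norm_nonneg _) h3).trans
          (hΓ σ ⟨hσ.1.le, hσ.2.trans hτ.2⟩)
    rw [sub_zero, abs_of_nonneg hτ.1] at this
    exact this.trans (mul_le_of_le_one_right hΓ0 hτ.2)
  calc _ ≤ Γ + Γ := (norm_sub_le _ _).trans (add_le_add h1 h2)
    _ = 2 * Γ := by ring

variable {x v x' v' : E} {X y w : ℝ → E}

/-- Only the stages carry a defect. In the two update identities that follow, `β` and `γ` are the
exact kernels and no such term appears. -/
theorem IsStep.stage_sub (hst : IsStep c F M h x v X x' v') (hc : c.IsAdmissible (h • M))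
    (hs : IsLocalSolution F (h • M) h y w)
    (hFX : ContinuousOn (fun τ => F (X τ)) (Set.Icc 0 1)) {τ : ℝ} (hτ : τ ∈ Set.Icc (0 : ℝ) 1) :
    X τ - y τ = (x - y 0) + h • psi (h • M) τ (v - w 0)
      + h ^ 2 • (∫ σ in (0 : ℝ)..1, c.α τ σ (h • M) (F (X σ) - F (y σ)))
      + h ^ 2 • stageDefect c F (h • M) y τ := by
  have h1 := hst.stage τ hτ
  have h2 := hs.y_eq hτ
  simp_rw [map_sub]
  rw [intervalIntegral.integral_sub
    (intervalIntegrable_of_continuousOn_Icc le_rfl zero_le_one le_rfl (hc.continuousOn_α τ hFX))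
    (intervalIntegrable_of_continuousOn_Icc le_rfl zero_le_one le_rfl
      (hc.continuousOn_α τ hs.cont)), stageDefect]
  have h3 : (τ * h) • phi 1 ((τ * h) • M) v = h • psi (h • M) τ v := by
    simp [psi, smul_smul, mul_comm]
  rw [h3] at h1
  rw [h1]
  nth_rw 1 [h2]
  module

theorem IsStep.x_sub (hst : IsStep c F M h x v X x' v') (hc : c.IsAdmissible (h • M))
    (hs : IsLocalSolution F (h • M) h y w)
    (hFX : ContinuousOn (fun τ => F (X τ)) (Set.Icc 0 1)) :
    x' - y 1 = (x - y 0) + h • psi (h • M) 1 (v - w 0)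
      + h ^ 2 • ∫ τ in (0 : ℝ)..1, psi (h • M) (1 - τ) (F (X τ) - F (y τ)) := by
  have h1 := hst.step_x
  have h2 := hs.y_eq (τ := 1) (by simp)
  have hce : Continuous fun σ : ℝ => psi (h • M) (1 - σ) :=
    (continuous_psi _).comp (by fun_prop : Continuous fun σ : ℝ => 1 - σ)
  simp_rw [map_sub]
  rw [intervalIntegral.integral_sub
    (intervalIntegrable_of_continuousOn_Icc le_rfl zero_le_one le_rfl
      (hce.continuousOn.clm_apply hFX))
    (intervalIntegrable_of_continuousOn_Icc le_rfl zero_le_one le_rfl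
      (hce.continuousOn.clm_apply hs.cont))]
  simp_rw [hc.β_eq] at h1
  have h3 : phi 1 (h • M) v = psi (h • M) 1 v := by simp [psi]
  rw [h1, h2, h3]
  module

theorem IsStep.v_sub (hst : IsStep c F M h x v X x' v') (hc : c.IsAdmissible (h • M))
    (hs : IsLocalSolution F (h • M) h y w)
    (hFX : ContinuousOn (fun τ => F (X τ)) (Set.Icc 0 1)) :
    v' - w 1 = NormedSpace.exp (h • M) (v - w 0)
      + h • ∫ τ in (0 : ℝ)..1, NormedSpace.exp ((1 - τ) • h • M) (F (X τ) - F (y τ)) := by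
  have h1 := hst.step_v
  have h2 := hs.w_eq (τ := 1) (by simp)
  have hce : Continuous fun σ : ℝ => NormedSpace.exp ((1 - σ) • h • M) :=
    (continuous_exp_smul _).comp (by fun_prop : Continuous fun σ : ℝ => 1 - σ)
  simp_rw [map_sub]
  rw [intervalIntegral.integral_sub
    (intervalIntegrable_of_continuousOn_Icc le_rfl zero_le_one le_rfl
      (hce.continuousOn.clm_apply hFX))
    (intervalIntegrable_of_continuousOn_Icc le_rfl zero_le_one le_rfl
      (hce.continuousOn.clm_apply hs.cont))]
  simp_rw [hc.γ_eq, phi_zero] at h1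
  rw [one_smul] at h2
  rw [h1, h2]
  module

end OneStep

/-! ### Uniform local error and the error recursion -/

section CrudeBounds

variable {E : Type*} [NormedAddCommGroup E] [NormedSpace ℝ E] [CompleteSpace E]
  {c : Coeffs E} {F : E → E} {M : E →L[ℝ] E} {h Γ : ℝ} {L : ℝ≥0} {R : ℝ≥0∞}
  {x v x' v' : E} {X y w : ℝ → E}

theorem IsStep.norm_stage_sub_le (hst : IsStep c F M h x v X x' v')
    (hZ : ∀ s : ℝ, ‖NormedSpace.exp (s • h • M)‖ ≤ 1) (hc : c.IsAdmissible (h • M))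
    (hs : IsLocalSolution F (h • M) h y w) (hR : 0 < R)
    (hL : ∀ τ ∈ Set.Icc (0 : ℝ) 1, LipschitzOnWith L F (Metric.eball (y τ) R))
    (hX : ∀ τ ∈ Set.Icc (0 : ℝ) 1, X τ ∈ Metric.eball (y τ) R)
    (hΓ : ∀ τ ∈ Set.Icc (0 : ℝ) 1, ‖F (y τ)‖ ≤ Γ) (hh : 0 ≤ h) (hhL : h ^ 2 * L ≤ 1 / 2)
    {τ : ℝ} (hτ : τ ∈ Set.Icc (0 : ℝ) 1) :
    ‖X τ - y τ‖ ≤ 2 * (‖x - y 0‖ + h * ‖v - w 0‖ + 2 * Γ * h ^ 2) := by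
  have hFX := continuousOn_comp_of_strip hL hX hst.cont
  -- The stage equation is implicit. Evaluating it where the stage error is largest lets `h² L ≤
  -- 1/2` absorb that maximum into the left side, which is the origin of the factor 2.
  obtain ⟨τ₀, hτ₀, hmax⟩ := isCompact_Icc.exists_isMaxOn (Set.nonempty_Icc.2 zero_le_one)
    (hst.cont.sub hs.continuousOn_y).norm
  have hmax' : ∀ σ ∈ Set.Icc (0 : ℝ) 1, ‖X σ - y σ‖ ≤ ‖X τ₀ - y τ₀‖ := fun σ hσ => hmax hσ
  set S := ‖X τ₀ - y τ₀‖ with hS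
  have h1 : ‖∫ σ in (0 : ℝ)..1, c.α τ₀ σ (h • M) (F (X σ) - F (y σ))‖ ≤ L * S :=
    norm_integral_α_le hc hτ₀ fun σ hσ =>
      (norm_sub_le_of_strip hR hL hX hσ).trans (mul_le_mul_of_nonneg_left (hmax' σ hσ) L.2)
  have h2 := norm_stageDefect_le hZ hc hτ₀ hΓ
  have h3 : ‖psi (h • M) τ₀ (v - w 0)‖ ≤ ‖v - w 0‖ :=
    (ContinuousLinearMap.le_opNorm _ _).trans (mul_le_of_le_one_left (norm_nonneg _)
      ((norm_psi_le hZ _).trans (abs_le.2 ⟨by linarith [hτ₀.1], hτ₀.2⟩)))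
  have h4 : S ≤ ‖x - y 0‖ + h * ‖v - w 0‖ + h ^ 2 * (L * S) + h ^ 2 * (2 * Γ) := by
    refine ((congrArg norm (hst.stage_sub hc hs hFX hτ₀)).trans_le norm_add₄_le).trans ?_
    simp only [norm_smul, Real.norm_eq_abs, abs_of_nonneg hh, abs_of_nonneg (sq_nonneg h)]
    gcongr
  have h5 : h ^ 2 * (L * S) ≤ 1 / 2 * S := by
    rw [← mul_assoc]; exact mul_le_mul_of_nonneg_right hhL (norm_nonneg _)
  refine (hmax' τ hτ).trans ?_
  linarith

theorem IsStep.norm_error_le (hst : IsStep c F M h x v X x' v')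
    (hZ : ∀ s : ℝ, ‖NormedSpace.exp (s • h • M)‖ ≤ 1) (hc : c.IsAdmissible (h • M))
    (hs : IsLocalSolution F (h • M) h y w) (hR : 0 < R)
    (hL : ∀ τ ∈ Set.Icc (0 : ℝ) 1, LipschitzOnWith L F (Metric.eball (y τ) R))
    (hX : ∀ τ ∈ Set.Icc (0 : ℝ) 1, X τ ∈ Metric.eball (y τ) R)
    (hΓ : ∀ τ ∈ Set.Icc (0 : ℝ) 1, ‖F (y τ)‖ ≤ Γ) (hh : 0 ≤ h) (hh1 : h ≤ 1)
    (hhL : h ^ 2 * L ≤ 1 / 2) :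
    ‖x' - y 1‖ + ‖v' - w 1‖ ≤ (1 + (1 + 4 * L) * h) * (‖x - y 0‖ + ‖v - w 0‖)
      + (1 + 4 * L) * h * (2 * Γ * h ^ 2) := by
  have hFX := continuousOn_comp_of_strip hL hX hst.cont
  have hΓ0 : 0 ≤ Γ := (norm_nonneg _).trans (hΓ 0 (by simp))
  have hL0 : (0 : ℝ) ≤ L := L.2
  set s := ‖x - y 0‖ with hs_def
  set r := ‖v - w 0‖ with hr_def
  have hd : ∀ τ ∈ Set.Icc (0 : ℝ) 1, ‖F (X τ) - F (y τ)‖ ≤ L * (2 * (s + r + 2 * Γ * h ^ 2)) := by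
    intro τ hτ
    have h1 := hst.norm_stage_sub_le hZ hc hs hR hL hX hΓ hh hhL hτ
    refine (norm_sub_le_of_strip hR hL hX hτ).trans (mul_le_mul_of_nonneg_left (h1.trans ?_) hL0)
    have : h * r ≤ r := mul_le_of_le_one_left (norm_nonneg _) hh1
    linarith
  have hpsi : ∀ τ ∈ Set.Icc (0 : ℝ) 1, ‖psi (h • M) τ‖ ≤ 1 := fun τ hτ =>
    (norm_psi_le hZ _).trans (abs_le.2 ⟨by linarith [hτ.1], hτ.2⟩)
  have hx : ‖x' - y 1‖ ≤ s + h * r + h ^ 2 * (L * (2 * (s + r + 2 * Γ * h ^ 2))) := by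
    rw [hst.x_sub hc hs hFX]
    refine norm_add₃_le.trans ?_
    simp only [norm_smul, Real.norm_eq_abs, abs_of_nonneg hh, abs_of_nonneg (sq_nonneg h)]
    gcongr
    · exact (ContinuousLinearMap.le_opNorm _ _).trans
        (mul_le_of_le_one_left (norm_nonneg _) (hpsi 1 (by simp)))
    · refine norm_integral_unit_le fun τ hτ => (ContinuousLinearMap.le_opNorm _ _).trans
        ((mul_le_of_le_one_left (norm_nonneg _) (hpsi _ ?_)).trans (hd τ hτ))
      exact ⟨by linarith [hτ.2], by linarith [hτ.1]⟩
  have hv : ‖v' - w 1‖ ≤ r + h * (L * (2 * (s + r + 2 * Γ * h ^ 2))) := by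
    rw [hst.v_sub hc hs hFX]
    refine (norm_add_le _ _).trans ?_
    simp only [norm_smul, Real.norm_eq_abs, abs_of_nonneg hh]
    gcongr
    · have := hZ 1
      rw [one_smul] at this
      exact (ContinuousLinearMap.le_opNorm _ _).trans (mul_le_of_le_one_left (norm_nonneg _) this)
    · exact norm_integral_unit_le fun τ hτ => (ContinuousLinearMap.le_opNorm _ _).trans
        ((mul_le_of_le_one_left (norm_nonneg _) (hZ _)).trans (hd τ hτ))
  have hB : 0 ≤ L * (2 * (s + r + 2 * Γ * h ^ 2)) := by positivity
  have h2 : h ^ 2 * (L * (2 * (s + r + 2 * Γ * h ^ 2)))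
      ≤ h * (L * (2 * (s + r + 2 * Γ * h ^ 2))) := by
    refine mul_le_mul_of_nonneg_right ?_ hB
    nlinarith
  have h3 : 0 ≤ h * s := by positivity
  have h4 : 0 ≤ h * (2 * Γ * h ^ 2) := by positivity
  nlinarith

/-- The shifted quantity `a m + δ` grows by at most the factor `1 + K h ≤ exp (K h)` per step. -/
theorem le_exp_of_recursion {a : ℕ → ℝ} {K δ h : ℝ} (hK : 0 ≤ K) (hδ : 0 ≤ δ) (hh : 0 ≤ h)
    (h0 : a 0 = 0) {n : ℕ}
    (ha : ∀ m < n, a (m + 1) ≤ (1 + K * h) * a m + K * h * δ) :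
    a n ≤ δ * Real.exp (K * (n * h)) := by
  suffices hk : a n + δ ≤ δ * Real.exp (K * (n * h)) by linarith
  induction n with
  | zero => simp [h0]
  | succ n ih =>
    have h1 := ih fun m hm => ha m (by omega)
    have h2 := ha n (by omega)
    have h3 : 0 ≤ K * h := mul_nonneg hK hh
    calc a (n + 1) + δ ≤ (1 + K * h) * (a n + δ) := by linarith
      _ ≤ (1 + K * h) * (δ * Real.exp (K * (n * h))) := by gcongr
      _ ≤ Real.exp (K * h) * (δ * Real.exp (K * (n * h))) := by
          gcongr
          linarith [Real.add_one_le_exp (K * h)]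
      _ = δ * Real.exp (K * ((n + 1 : ℕ) * h)) := by
          rw [mul_left_comm, ← Real.exp_add]; push_cast; ring_nf

end CrudeBounds

/-! ### Solvability of the stage equations -/

section Existence

variable {E : Type*} [NormedAddCommGroup E] [NormedSpace ℝ E]
  {c : Coeffs E} {F : E → E} {M : E →L[ℝ] E} {h Γ : ℝ} {L : ℝ≥0} {R : ℝ≥0∞}

/-- The hypothesis `H` produces step `n` from an arbitrary good prefix, so that it can be proved
with the error bound for the preceding steps in hand. -/
theorem exists_numericalSolution {T : ℝ} {x₀ v₀ : E} {x : ℝ → E} (hh : 0 ≤ h)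
    (H : ∀ n : ℕ, ((n : ℝ) + 1) * h ≤ T → ∀ (xn vn : ℕ → E) (X : ℕ → ℝ → E),
      xn 0 = x₀ → vn 0 = v₀ →
      (∀ m < n, IsStep c F M h (xn m) (vn m) (X m) (xn (m + 1)) (vn (m + 1)) ∧
        ∀ τ ∈ Set.Icc (0 : ℝ) 1, X m τ ∈ Metric.eball (x (((m : ℝ) + τ) * h)) R) →
      ∃ (X' : ℝ → E) (x' v' : E), IsStep c F M h (xn n) (vn n) X' x' v' ∧
        ∀ τ ∈ Set.Icc (0 : ℝ) 1, X' τ ∈ Metric.eball (x (((n : ℝ) + τ) * h)) R) :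
    ∃ (xn vn : ℕ → E) (X : ℕ → ℝ → E),
      IsNumericalSolution c F M T h x₀ v₀ xn vn X ∧ StagesInStrip R T h x X := by
  classical
  let good : ℕ → E × E → (ℝ → E) × E × E → Prop := fun n q p =>
    IsStep c F M h q.1 q.2 p.1 p.2.1 p.2.2 ∧
      ∀ τ ∈ Set.Icc (0 : ℝ) 1, p.1 τ ∈ Metric.eball (x (((n : ℝ) + τ) * h)) R
  -- The default `(0, 0, 0)` is reached only when no good step exists, hence never for a step ending
  -- by time `T`.
  let next : ℕ → E × E → (ℝ → E) × E × E := fun n q =>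
    if hq : ∃ p, good n q p then hq.choose else (0, 0, 0)
  have hnext : ∀ n q, (∃ p, good n q p) → good n q (next n q) := by
    intro n q hq
    simp only [next, dif_pos hq]
    exact hq.choose_spec
  let q : ℕ → E × E := fun n => Nat.rec (x₀, v₀) (fun n q => (next n q).2) n
  have hq : ∀ n : ℕ, ((n : ℝ) + 1) * h ≤ T → good n (q n) (next n (q n)) := by
    intro n
    induction n using Nat.strong_induction_on with
    | _ n ih =>
      intro hn
      obtain ⟨X', x', v', h1, h2⟩ := H n hn (fun n => (q n).1) (fun n => (q n).2)
        (fun n => (next n (q n)).1) rfl rfl (fun m hm => by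
          have hm' : (m : ℝ) ≤ n := by exact_mod_cast hm.le
          exact ih m hm ((mul_le_mul_of_nonneg_right (by linarith) hh).trans hn))
      exact hnext n _ ⟨(X', x', v'), h1, h2⟩
  exact ⟨fun n => (q n).1, fun n => (q n).2, fun n => (next n (q n)).1,
    ⟨rfl, rfl, fun n hn => (hq n hn).1⟩, fun n hn => (hq n hn).2⟩

variable [CompleteSpace E] {x v : E} {y w : ℝ → E} {ρ : ℝ}

/-- Banach's fixed point theorem on the closed ball of radius `ρ` about the exact solution in
`C([0,1], E)`. The ball lies in the strip, so `F` is Lipschitz there; `hρh` makes the stage map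
preserve the ball and `h² L ≤ 1/2` makes it a contraction. -/
theorem exists_isStep (hZ : ∀ s : ℝ, ‖NormedSpace.exp (s • h • M)‖ ≤ 1)
    (hc : c.IsAdmissible (h • M)) (hs : IsLocalSolution F (h • M) h y w)
    (hL : ∀ τ ∈ Set.Icc (0 : ℝ) 1, LipschitzOnWith L F (Metric.eball (y τ) R))
    (hΓ : ∀ τ ∈ Set.Icc (0 : ℝ) 1, ‖F (y τ)‖ ≤ Γ) (hh : 0 ≤ h) (hhL : h ^ 2 * L ≤ 1 / 2)
    (hρ : 0 ≤ ρ) (hρR : ENNReal.ofReal ρ < R)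
    (hρh : ‖x - y 0‖ + h * ‖v - w 0‖ + h ^ 2 * (L * ρ) + h ^ 2 * (2 * Γ) ≤ ρ) :
    ∃ (X : ℝ → E) (x' v' : E), IsStep c F M h x v X x' v' ∧
      ∀ τ ∈ Set.Icc (0 : ℝ) 1, X τ ∈ Metric.eball (y τ) R := by
  let I := Set.Icc (0 : ℝ) 1
  let yI : C(I, E) := ⟨I.domRestrict y, hs.continuousOn_y.domRestrict⟩
  -- Constant extension beyond `[0,1]`, so that interval integrals over `ℝ` apply.
  let ext : C(I, E) → ℝ → E := fun X => Set.IccExtend zero_le_one X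
  have hext_cont : ∀ X, Continuous (ext X) := fun X => X.continuous.Icc_extend'
  have hext : ∀ X (τ : I), ext X τ = X τ := fun X τ => Set.IccExtend_val _ _ _
  have hproj : ∀ X σ, ext X σ = X (Set.projIcc 0 1 zero_le_one σ) := fun X σ => rfl
  have hball : ∀ X ∈ Metric.closedBall yI ρ, ∀ τ : I, ‖X τ - y τ‖ ≤ ρ := fun X hX τ => by
    rw [← dist_eq_norm]
    exact (ContinuousMap.dist_apply_le_dist (f := X) (g := yI) τ).trans hX
  have hmem : ∀ z : E, ∀ τ : I, ‖z - y τ‖ ≤ ρ → z ∈ Metric.eball (y τ) R := fun z τ hz => by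
    rw [Metric.mem_eball, edist_dist, dist_eq_norm]
    exact (ENNReal.ofReal_le_ofReal hz).trans_lt hρR
  have hFc : ∀ X ∈ Metric.closedBall yI ρ, Continuous fun σ => F (ext X σ) := by
    intro X hX
    refine continuous_iff_continuousAt.2 fun σ => ?_
    have h1 : ContinuousAt F (ext X σ) := by
      have := hmem _ _ (hball X hX (Set.projIcc 0 1 zero_le_one σ))
      exact (hL _ (Set.projIcc 0 1 zero_le_one σ).2).continuousOn.continuousAt
        (Metric.isOpen_eball.mem_nhds this)
    exact ContinuousAt.comp (f := ext X) (g := F) h1 (hext_cont X).continuousAt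
  let Φ : (ℝ → E) → ℝ → E := fun f τ =>
    x + h • psi (h • M) τ v + h ^ 2 • ∫ σ in (0 : ℝ)..1, c.α τ σ (h • M) (F (f σ))
  have hΦc : ∀ X ∈ Metric.closedBall yI ρ, Continuous (Φ (ext X)) := by
    intro X hX
    have h1 : Continuous fun τ : ℝ => ∫ σ in (0 : ℝ)..1, c.α τ σ (h • M) (F (ext X σ)) := by
      apply intervalIntegral.continuous_parametric_intervalIntegral_of_continuous'
      exact hc.cont_α.clm_apply ((hFc X hX).comp continuous_snd)
    exact (continuous_const.add (((continuous_psi (h • M)).clm_apply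
      continuous_const).const_smul h)).add (h1.const_smul _)
  have hFLip : ∀ X ∈ Metric.closedBall yI ρ, ∀ Y ∈ Metric.closedBall yI ρ,
      ∀ σ ∈ I, ‖F (ext X σ) - F (ext Y σ)‖ ≤ L * dist X Y := by
    intro X hX Y hY σ hσ
    have e : ∀ X : C(I, E), ext X σ = X ⟨σ, hσ⟩ := fun X => hext X ⟨σ, hσ⟩
    rw [e, e]
    refine ((hL σ hσ).norm_sub_le (hmem _ ⟨σ, hσ⟩ (hball X hX _))
      (hmem _ ⟨σ, hσ⟩ (hball Y hY _))).trans (mul_le_mul_of_nonneg_left ?_ L.2)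
    rw [← dist_eq_norm]
    exact ContinuousMap.dist_apply_le_dist _
  have hyI : yI ∈ Metric.closedBall yI ρ := Metric.mem_closedBall_self hρ
  have hint : ∀ X ∈ Metric.closedBall yI ρ, ∀ τ, IntervalIntegrable
      (fun σ => c.α τ σ (h • M) (F (ext X σ))) MeasureTheory.volume 0 1 := fun X hX τ =>
    intervalIntegrable_of_continuousOn_Icc le_rfl zero_le_one le_rfl
      (hc.continuousOn_α τ (hFc X hX).continuousOn)
  have hΦ_sub : ∀ X ∈ Metric.closedBall yI ρ, ∀ Y ∈ Metric.closedBall yI ρ, ∀ τ : I,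
      ‖h ^ 2 • (∫ σ in (0 : ℝ)..1, c.α τ σ (h • M) (F (ext X σ)))
        - h ^ 2 • ∫ σ in (0 : ℝ)..1, c.α τ σ (h • M) (F (ext Y σ))‖
        ≤ h ^ 2 * (L * dist X Y) := by
    intro X hX Y hY τ
    rw [← smul_sub, ← intervalIntegral.integral_sub (hint X hX τ) (hint Y hY τ), norm_smul,
      Real.norm_eq_abs, abs_of_nonneg (sq_nonneg h)]
    simp_rw [← map_sub]
    exact mul_le_mul_of_nonneg_left (norm_integral_α_le hc τ.2 (hFLip X hX Y hY)) (sq_nonneg h)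
  have hΦ_mem : ∀ X ∈ Metric.closedBall yI ρ, ∃ Y ∈ Metric.closedBall yI ρ,
      ∀ τ : I, Y τ = Φ (ext X) τ := by
    intro X hX
    refine ⟨⟨fun τ : I => Φ (ext X) τ, (hΦc X hX).comp continuous_subtype_val⟩, ?_, fun _ => rfl⟩
    refine (ContinuousMap.dist_le hρ).2 fun τ => ?_
    rw [dist_eq_norm]
    have e1 : ∫ σ in (0 : ℝ)..1, c.α τ σ (h • M) (F (ext yI σ))
        = ∫ σ in (0 : ℝ)..1, c.α τ σ (h • M) (F (y σ)) := by
      refine intervalIntegral.integral_congr fun σ hσ => ?_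
      rw [Set.uIcc_of_le zero_le_one] at hσ
      rw [hext yI ⟨σ, hσ⟩]
      rfl
    -- The four terms match those of `hρh`: incoming position and velocity errors, the Lipschitz
    -- change from `y` to `X`, and the stage defect.
    have e2 : Φ (ext X) τ - y τ = (x - y 0) + h • psi (h • M) τ (v - w 0)
        + (h ^ 2 • (∫ σ in (0 : ℝ)..1, c.α τ σ (h • M) (F (ext X σ)))
          - h ^ 2 • ∫ σ in (0 : ℝ)..1, c.α τ σ (h • M) (F (ext yI σ)))
        + h ^ 2 • stageDefect c F (h • M) y τ := by
      rw [hs.y_eq τ.2, stageDefect, e1, map_sub]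
      module
    change ‖Φ (ext X) τ - y τ‖ ≤ ρ
    rw [e2]
    refine norm_add₄_le.trans (le_trans ?_ hρh)
    have h1 := hΦ_sub X hX yI hyI τ
    have h2 := norm_stageDefect_le hZ hc τ.2 hΓ
    have h3 : ‖psi (h • M) τ (v - w 0)‖ ≤ ‖v - w 0‖ :=
      (ContinuousLinearMap.le_opNorm _ _).trans (mul_le_of_le_one_left (norm_nonneg _)
        ((norm_psi_le hZ _).trans (abs_le.2 ⟨by linarith [τ.2.1], τ.2.2⟩)))
    have h4 : dist X yI ≤ ρ := hX
    refine add_le_add (add_le_add (add_le_add le_rfl ?_) (h1.trans ?_)) ?_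
    · rw [norm_smul, Real.norm_eq_abs, abs_of_nonneg hh]
      gcongr
    · gcongr
    · rw [norm_smul, Real.norm_eq_abs, abs_of_nonneg (sq_nonneg h)]
      gcongr
  choose! Ψ hΨmem hΨ using hΦ_mem
  let f : Metric.closedBall yI ρ → Metric.closedBall yI ρ := fun X => ⟨Ψ X, hΨmem X X.2⟩
  have hf : ContractingWith (1 / 2 : ℝ≥0) f := by
    refine ⟨by norm_num, LipschitzWith.of_dist_le_mul fun X Y => ?_⟩
    change dist (Ψ X) (Ψ Y) ≤ _ * dist (X : C(I, E)) Y
    refine (ContinuousMap.dist_le (by positivity)).2 fun τ => ?_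
    rw [dist_eq_norm, hΨ X X.2, hΨ Y Y.2]
    simp only [Φ, add_sub_add_left_eq_sub]
    refine (hΦ_sub X X.2 Y Y.2 τ).trans ?_
    rw [← mul_assoc]
    refine mul_le_mul_of_nonneg_right (hhL.trans (by norm_num)) dist_nonneg
  have : Nonempty (Metric.closedBall yI ρ) := ⟨⟨yI, hyI⟩⟩
  have : CompleteSpace (Metric.closedBall yI ρ) :=
    (Metric.isClosed_closedBall.isComplete).completeSpace_coe
  obtain ⟨X, hX⟩ : ∃ X, f X = X := ⟨_, hf.fixedPoint_isFixedPt⟩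
  have hX' : ∀ τ : I, (X : C(I, E)) τ = Φ (ext X) τ := fun τ => by
    rw [← hΨ X X.2 τ]
    exact congrArg (fun Y : Metric.closedBall yI ρ => (Y : C(I, E)) τ) hX.symm
  refine ⟨ext X, _, _, ⟨(hext_cont _).continuousOn, fun τ hτ => ?_, rfl, rfl⟩, fun τ hτ => ?_⟩
  · rw [hext _ ⟨τ, hτ⟩, hX' ⟨τ, hτ⟩]
    simp [Φ, psi, smul_smul, mul_comm]
  · rw [hext _ ⟨τ, hτ⟩]
    exact hmem _ ⟨τ, hτ⟩ (hball _ X.2 _)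

end Existence

/-! ### First-order expansions in `η` -/

section Expansions

/-- `f = a + b + O(η²)` on the unit interval, with `a = O(1)` and `b = O(η)`. -/
structure IsExpansion {G : Type*} [NormedAddCommGroup G] (k η : ℝ) (f a b : ℝ → G) : Prop where
  a_le : ∀ τ ∈ Set.Icc (0 : ℝ) 1, ‖a τ‖ ≤ k
  b_le : ∀ τ ∈ Set.Icc (0 : ℝ) 1, ‖b τ‖ ≤ k * η
  sub_le : ∀ τ ∈ Set.Icc (0 : ℝ) 1, ‖f τ - a τ - b τ‖ ≤ k * η ^ 2

variable {E G : Type*} [NormedAddCommGroup E] [NormedSpace ℝ E] [NormedAddCommGroup G]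
  [NormedSpace ℝ G] {k k' η N : ℝ}

/-- A Leibniz rule. The factor `3 + 2N + N²` is the sum of the four remainder terms, with `η ≤ N`
used to bound the higher powers. -/
theorem IsExpansion.clm_apply {f a b : ℝ → E →L[ℝ] G} {g a' b' : ℝ → E}
    (hf : IsExpansion k η f a b) (hg : IsExpansion k' η g a' b') (hk : 0 ≤ k) (hk' : 0 ≤ k')
    (hη : 0 ≤ η) (hN : η ≤ N) :
    IsExpansion (k * k' * (3 + 2 * N + N ^ 2)) η (fun τ => f τ (g τ)) (fun τ => a τ (a' τ))
      (fun τ => a τ (b' τ) + b τ (a' τ)) := by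
  have hN0 : 0 ≤ N := hη.trans hN
  have hkk : 0 ≤ k * k' := mul_nonneg hk hk'
  refine ⟨fun τ hτ => ?_, fun τ hτ => ?_, fun τ hτ => ?_⟩
  · calc ‖a τ (a' τ)‖ ≤ ‖a τ‖ * ‖a' τ‖ := (a τ).le_opNorm _
      _ ≤ k * k' := mul_le_mul (hf.a_le τ hτ) (hg.a_le τ hτ) (norm_nonneg _) hk
      _ ≤ _ := le_mul_of_one_le_right hkk (by nlinarith)
  · calc ‖a τ (b' τ) + b τ (a' τ)‖ ≤ ‖a τ‖ * ‖b' τ‖ + ‖b τ‖ * ‖a' τ‖ :=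
          (norm_add_le _ _).trans (add_le_add ((a τ).le_opNorm _) ((b τ).le_opNorm _))
      _ ≤ k * (k' * η) + (k * η) * k' := by
          gcongr
          exacts [hf.a_le τ hτ, hg.b_le τ hτ, hf.b_le τ hτ, hg.a_le τ hτ]
      _ = k * k' * η * 2 := by ring
      _ ≤ k * k' * η * (3 + 2 * N + N ^ 2) := by gcongr; nlinarith
      _ = _ := by ring
  · have e : f τ (g τ) - a τ (a' τ) - (a τ (b' τ) + b τ (a' τ))
        = a τ (g τ - a' τ - b' τ) + b τ (b' τ) + b τ (g τ - a' τ - b' τ)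
          + (f τ - a τ - b τ) (a' τ + b' τ + (g τ - a' τ - b' τ)) := by
      simp only [map_sub, map_add, sub_apply]
      abel
    have h3 : ‖a' τ + b' τ + (g τ - a' τ - b' τ)‖ ≤ k' + k' * η + k' * η ^ 2 :=
      norm_add₃_le.trans (add_le_add (add_le_add (hg.a_le τ hτ) (hg.b_le τ hτ)) (hg.sub_le τ hτ))
    rw [e]
    calc _ ≤ ‖a τ‖ * ‖g τ - a' τ - b' τ‖ + ‖b τ‖ * ‖b' τ‖ + ‖b τ‖ * ‖g τ - a' τ - b' τ‖
          + ‖f τ - a τ - b τ‖ * ‖a' τ + b' τ + (g τ - a' τ - b' τ)‖ :=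
          norm_add₄_le.trans (add_le_add (add_le_add (add_le_add (ContinuousLinearMap.le_opNorm _ _)
            (ContinuousLinearMap.le_opNorm _ _)) (ContinuousLinearMap.le_opNorm _ _))
            (ContinuousLinearMap.le_opNorm _ _))
      _ ≤ k * (k' * η ^ 2) + (k * η) * (k' * η) + (k * η) * (k' * η ^ 2)
          + (k * η ^ 2) * (k' + k' * η + k' * η ^ 2) := by
          gcongr
          exacts [hf.a_le τ hτ, hg.sub_le τ hτ, hf.b_le τ hτ, hg.b_le τ hτ, hf.b_le τ hτ,
            hg.sub_le τ hτ, hf.sub_le τ hτ]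
      _ = k * k' * (3 + 2 * η + η ^ 2) * η ^ 2 := by ring
      _ ≤ _ := by gcongr

omit [NormedSpace ℝ G] in
theorem IsExpansion.norm_sub_le {f a b : ℝ → G} (hf : IsExpansion k η f a b) (hk : 0 ≤ k)
    (hη : 0 ≤ η) (hN : η ≤ N) {τ : ℝ} (hτ : τ ∈ Set.Icc (0 : ℝ) 1) :
    ‖f τ - a τ‖ ≤ k * (1 + N) * η := by
  calc ‖f τ - a τ‖ = ‖(f τ - a τ - b τ) + b τ‖ := by rw [sub_add_cancel]
    _ ≤ k * η ^ 2 + k * η := (norm_add_le _ _).trans (add_le_add (hf.sub_le τ hτ) (hf.b_le τ hτ))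
    _ = k * (1 + η) * η := by ring
    _ ≤ _ := by gcongr

section Exponential

variable [CompleteSpace E] {Z : E →L[ℝ] E} (hZ : ∀ s : ℝ, ‖NormedSpace.exp (s • Z)‖ ≤ 1)
include hZ

theorem isExpansion_exp (hk : 1 ≤ k) (hη : 0 ≤ η) (hZk : ‖Z‖ ≤ k * η) :
    IsExpansion (k ^ 2) η (fun τ => NormedSpace.exp ((1 - τ) • Z)) (fun _ => 1)
      (fun τ => (1 - τ) • Z) := by
  have hk2 : k ≤ k ^ 2 := by nlinarith
  have hb : ∀ τ ∈ Set.Icc (0 : ℝ) 1, |1 - τ| ≤ 1 := fun τ hτ =>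
    abs_le.2 ⟨by linarith [hτ.2], by linarith [hτ.1]⟩
  refine ⟨fun τ _ => ?_, fun τ hτ => ?_, fun τ hτ => ?_⟩
  · exact ContinuousLinearMap.norm_id_le.trans (hk.trans hk2)
  · rw [norm_smul, Real.norm_eq_abs]
    calc _ ≤ 1 * (k * η) := by gcongr; exact hb τ hτ
      _ ≤ _ := by rw [one_mul]; gcongr
  · refine (norm_exp_smul_sub_linear_le hZ (hb τ hτ)).trans ?_
    rw [← mul_pow]
    gcongr

theorem isExpansion_phi_one (hk : 1 ≤ k) (hη : 0 ≤ η) (hZk : ‖Z‖ ≤ k * η) {τ : ℝ}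
    (hτ : τ ∈ Set.Icc (0 : ℝ) 1) :
    IsExpansion (k ^ 2) η (fun σ => phi 1 ((τ - σ) • Z)) (fun _ => 1)
      (fun σ => ((τ - σ) / 2) • Z) := by
  have hk2 : k ≤ k ^ 2 := by nlinarith
  have hb : ∀ σ ∈ Set.Icc (0 : ℝ) 1, |τ - σ| ≤ 1 := fun σ hσ =>
    abs_le.2 ⟨by linarith [hσ.2, hτ.1], by linarith [hσ.1, hτ.2]⟩
  refine ⟨fun σ _ => ?_, fun σ hσ => ?_, fun σ hσ => ?_⟩
  · exact ContinuousLinearMap.norm_id_le.trans (hk.trans hk2)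
  · rw [norm_smul, Real.norm_eq_abs]
    calc _ ≤ 1 * (k * η) := by
          gcongr
          rw [abs_div, abs_two]
          linarith [hb σ hσ, abs_nonneg (τ - σ)]
      _ ≤ _ := by rw [one_mul]; gcongr
  · refine (norm_phi_one_smul_sub_linear_le hZ (hb σ hσ)).trans ?_
    rw [← mul_pow]
    gcongr

theorem isExpansion_psi (hk : 1 ≤ k) (hη : 0 ≤ η) (hZk : ‖Z‖ ≤ k * η) :
    IsExpansion (k ^ 2) η (fun τ => psi Z (1 - τ)) (fun τ => (1 - τ) • 1)
      (fun τ => (1 - τ) • ((1 - τ) / 2) • Z) := by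
  have h := isExpansion_phi_one hZ hk hη hZk (τ := 1) (by simp)
  have hb : ∀ τ ∈ Set.Icc (0 : ℝ) 1, ‖1 - τ‖ ≤ 1 := fun τ hτ =>
    abs_le.2 ⟨by linarith [hτ.2], by linarith [hτ.1]⟩
  refine ⟨fun τ hτ => ?_, fun τ hτ => ?_, fun τ hτ => ?_⟩
  · rw [norm_smul]
    exact (mul_le_of_le_one_left (norm_nonneg _) (hb τ hτ)).trans (h.a_le τ hτ)
  · rw [norm_smul]
    exact (mul_le_of_le_one_left (norm_nonneg _) (hb τ hτ)).trans (h.b_le τ hτ)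
  · rw [psi, ← smul_sub, ← smul_sub, norm_smul]
    exact (mul_le_of_le_one_left (norm_nonneg _) (hb τ hτ)).trans (h.sub_le τ hτ)

end Exponential

end Expansions

/-! ### Expansion of the fourth-order stage defect -/

section FourthOrderDefect

theorem integral_cubic (c₀ c₁ c₂ c₃ b : ℝ) :
    ∫ x in (0 : ℝ)..b, (c₀ + c₁ * x + c₂ * x ^ 2 + c₃ * x ^ 3)
      = c₀ * b + c₁ * b ^ 2 / 2 + c₂ * b ^ 3 / 3 + c₃ * b ^ 4 / 4 := by
  have hd : ∀ x : ℝ, HasDerivAt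
      (fun x : ℝ => c₀ * x + c₁ * x ^ 2 / 2 + c₂ * x ^ 3 / 3 + c₃ * x ^ 4 / 4)
      (c₀ + c₁ * x + c₂ * x ^ 2 + c₃ * x ^ 3) x := fun x => by
    have h := ((((hasDerivAt_id' x).const_mul c₀).add
      (((hasDerivAt_pow 2 x).const_mul c₁).div_const 2)).add
      (((hasDerivAt_pow 3 x).const_mul c₂).div_const 3)).add
      (((hasDerivAt_pow 4 x).const_mul c₃).div_const 4)
    refine h.congr_deriv ?_
    push_cast
    ring
  rw [intervalIntegral.integral_eq_sub_of_hasDerivAt (fun x _ => hd x)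
    ((by fun_prop : Continuous _).intervalIntegrable _ _)]
  simp

theorem integral_eq_of_eq_cubic {f : ℝ → ℝ} (c₀ c₁ c₂ c₃ b : ℝ)
    (hf : ∀ x, f x = c₀ + c₁ * x + c₂ * x ^ 2 + c₃ * x ^ 3) :
    ∫ x in (0 : ℝ)..b, f x = c₀ * b + c₁ * b ^ 2 / 2 + c₂ * b ^ 3 / 3 + c₃ * b ^ 4 / 4 := by
  rw [← integral_cubic]
  simp_rw [hf]

variable {E : Type*} [NormedAddCommGroup E] [NormedSpace ℝ E] [CompleteSpace E]

theorem integral_smul_sub_three {κ : ℝ → ℝ} {κ₀ κ₁ κ₂ : ℝ → ℝ} {f : ℝ → E} {b : ℝ}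
    (u₀ u₁ u₂ : E) (hb : b ∈ Set.Icc (0 : ℝ) 1) (hκ : Continuous κ) (h0 : Continuous κ₀)
    (h1 : Continuous κ₁) (h2 : Continuous κ₂) (hf : ContinuousOn f (Set.Icc 0 1)) :
    ∫ σ in (0 : ℝ)..b, κ σ • (f σ - κ₀ σ • u₀ - (κ₁ σ • u₁ + κ₂ σ • u₂))
      = (∫ σ in (0 : ℝ)..b, κ σ • f σ) - (∫ σ in (0 : ℝ)..b, κ σ * κ₀ σ) • u₀
        - ((∫ σ in (0 : ℝ)..b, κ σ * κ₁ σ) • u₁ + (∫ σ in (0 : ℝ)..b, κ σ * κ₂ σ) • u₂) := by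
  have i0 : IntervalIntegrable (fun σ => κ σ • f σ) MeasureTheory.volume 0 b :=
    intervalIntegrable_of_continuousOn_Icc le_rfl hb.1 hb.2 (hκ.continuousOn.smul hf)
  have i1 : ∀ (g : ℝ → ℝ) (u : E), Continuous g →
      IntervalIntegrable (fun σ => (κ σ * g σ) • u) MeasureTheory.volume 0 b := fun g u hg =>
    ((hκ.mul hg).smul continuous_const).intervalIntegrable _ _
  rw [← intervalIntegral.integral_smul_const (fun σ => κ σ * κ₀ σ),
    ← intervalIntegral.integral_smul_const (fun σ => κ σ * κ₁ σ),
    ← intervalIntegral.integral_smul_const (fun σ => κ σ * κ₂ σ),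
    ← intervalIntegral.integral_sub i0 (i1 _ _ h0),
    ← intervalIntegral.integral_add (i1 _ _ h1) (i1 _ _ h2),
    ← intervalIntegral.integral_sub (i0.sub (i1 _ _ h0)) ((i1 _ _ h1).add (i1 _ _ h2))]
  refine intervalIntegral.integral_congr fun σ _ => ?_
  module

variable {F : E → E} {Z : E →L[ℝ] E} {y : ℝ → E} {k η N : ℝ} {G₀ G₁ : E}

/-- With `φ₁((τ-σ)Z) ≈ 1 + (τ-σ)Z/2` and `F(y σ) ≈ G₀ + σ G₁`, the polynomials are differences of
moments of the weights `1/6 + (τ-σ)/2` on `[0,1]` and `τ-σ` on `[0,τ]`. -/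
theorem isExpansion_stageDefect (hZ : ∀ s : ℝ, ‖NormedSpace.exp (s • Z)‖ ≤ 1)
    (hFy : ContinuousOn (fun τ => F (y τ)) (Set.Icc 0 1)) (hk : 1 ≤ k) (hη : 0 ≤ η) (hN : η ≤ N)
    (hZk : ‖Z‖ ≤ k * η)
    (hG : IsExpansion k η (fun τ => F (y τ)) (fun _ => G₀) (fun τ => τ • G₁)) :
    IsExpansion (2 * (k ^ 2 * k * (3 + 2 * N + N ^ 2))) η (stageDefect fourthOrder F Z y)
      (fun τ => (-1 / 12 + τ / 2 - τ ^ 2 / 2) • G₀)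
      (fun τ => (1 / 24 - τ / 6 + τ ^ 2 / 4 - τ ^ 3 / 6) • Z G₀
        + (-1 / 12 + τ / 4 - τ ^ 3 / 6) • G₁) := by
  have hN0 : 0 ≤ N := hη.trans hN
  have hk0 : 0 ≤ k := zero_le_one.trans hk
  set K := k ^ 2 * k * (3 + 2 * N + N ^ 2) with hK
  have hkK : k ^ 2 ≤ K := by
    have h1 : k ^ 2 ≤ k ^ 2 * k := le_mul_of_one_le_right (by positivity) hk
    exact h1.trans (le_mul_of_one_le_right (by positivity) (by nlinarith))
  have hkk : k ≤ k ^ 2 := by nlinarith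
  have hG0 : ‖G₀‖ ≤ k := hG.a_le 0 (by simp)
  have hG1 : ‖G₁‖ ≤ k * η := by simpa using hG.b_le 1 (by simp)
  refine ⟨fun τ hτ => ?_, fun τ hτ => ?_, fun τ hτ => ?_⟩
  · rw [norm_smul, Real.norm_eq_abs]
    have : |-1 / 12 + τ / 2 - τ ^ 2 / 2| ≤ 1 :=
      abs_le.2 ⟨by nlinarith [hτ.1, hτ.2], by nlinarith [hτ.1, hτ.2]⟩
    refine (mul_le_of_le_one_left (norm_nonneg _) this).trans ?_
    linarith
  · have a1 : |1 / 24 - τ / 6 + τ ^ 2 / 4 - τ ^ 3 / 6| ≤ 1 := by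
      have := pow_le_one₀ hτ.1 hτ.2 (n := 2)
      have := pow_le_one₀ hτ.1 hτ.2 (n := 3)
      have := pow_nonneg hτ.1 2
      have := pow_nonneg hτ.1 3
      exact abs_le.2 ⟨by linarith [hτ.1, hτ.2], by linarith [hτ.1, hτ.2]⟩
    have a2 : |-1 / 12 + τ / 4 - τ ^ 3 / 6| ≤ 1 := by
      have := pow_le_one₀ hτ.1 hτ.2 (n := 3)
      have := pow_nonneg hτ.1 3
      exact abs_le.2 ⟨by linarith [hτ.1, hτ.2], by linarith [hτ.1, hτ.2]⟩
    have hZG : ‖Z G₀‖ ≤ k * η * k :=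
      (Z.le_opNorm _).trans (mul_le_mul hZk hG0 (norm_nonneg _) (by positivity))
    refine (norm_add_le _ _).trans ?_
    rw [norm_smul, norm_smul, Real.norm_eq_abs, Real.norm_eq_abs]
    have b1 := (mul_le_of_le_one_left (norm_nonneg (Z G₀)) a1).trans hZG
    have b2 := (mul_le_of_le_one_left (norm_nonneg G₁) a2).trans hG1
    calc _ ≤ k * η * k + k * η := add_le_add b1 b2
      _ = (k ^ 2 + k) * η := by ring
      _ ≤ (2 * K) * η := by gcongr; linarith
  · set f : ℝ → E := fun σ => phi 1 ((τ - σ) • Z) (F (y σ)) with hf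
    have hfc : ContinuousOn f (Set.Icc 0 1) :=
      ((continuous_phi_one_smul Z).comp
        (by fun_prop : Continuous fun σ : ℝ => τ - σ)).continuousOn.clm_apply hFy
    have hexp := (isExpansion_phi_one hZ hk hη hZk hτ).clm_apply hG (by positivity) hk0 hη hN
    have hrem : ∀ σ ∈ Set.Icc (0 : ℝ) 1,
        ‖f σ - (1 : ℝ) • G₀ - (((τ - σ) / 2) • Z G₀ + σ • G₁)‖ ≤ K * η ^ 2 := by
      intro σ hσ
      have := hexp.sub_le σ hσ
      simp only [one_apply_eq_self, smul_apply] at this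
      rw [one_smul, add_comm (_ • Z G₀)]
      exact this
    -- After evaluating the moments, the remainder of the defect is the defect functional applied to
    -- the remainder of the integrand, which is `O(η²)`.
    have key : stageDefect fourthOrder F Z y τ - (-1 / 12 + τ / 2 - τ ^ 2 / 2) • G₀
        - ((1 / 24 - τ / 6 + τ ^ 2 / 4 - τ ^ 3 / 6) • Z G₀ + (-1 / 12 + τ / 4 - τ ^ 3 / 6) • G₁)
        = (∫ σ in (0 : ℝ)..1, (1 / 6 + (τ - σ) / 2) •
            (f σ - (1 : ℝ) • G₀ - (((τ - σ) / 2) • Z G₀ + σ • G₁)))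
          - ∫ σ in (0 : ℝ)..τ, (τ - σ) •
            (f σ - (1 : ℝ) • G₀ - (((τ - σ) / 2) • Z G₀ + σ • G₁)) := by
      rw [integral_smul_sub_three (κ := fun σ => 1 / 6 + (τ - σ) / 2) (κ₀ := fun _ => 1)
          (κ₁ := fun σ => (τ - σ) / 2) (κ₂ := fun σ => σ) _ _ _ (by simp) (by fun_prop)
          (by fun_prop) (by fun_prop) (by fun_prop) hfc,
        integral_smul_sub_three (κ := fun σ => τ - σ) (κ₀ := fun _ => 1)
          (κ₁ := fun σ => (τ - σ) / 2) (κ₂ := fun σ => σ) _ _ _ hτ (by fun_prop)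
          (by fun_prop) (by fun_prop) (by fun_prop) hfc,
        integral_eq_of_eq_cubic (1 / 6 + τ / 2) (-1 / 2) 0 0 1 (fun σ => by ring),
        integral_eq_of_eq_cubic (τ / 12 + τ ^ 2 / 4) (-1 / 12 - τ / 2) (1 / 4) 0 1
          (fun σ => by ring),
        integral_eq_of_eq_cubic 0 (1 / 6 + τ / 2) (-1 / 2) 0 1 (fun σ => by ring),
        integral_eq_of_eq_cubic τ (-1) 0 0 τ (fun σ => by ring),
        integral_eq_of_eq_cubic (τ ^ 2 / 2) (-τ) (1 / 2) 0 τ (fun σ => by ring),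
        integral_eq_of_eq_cubic 0 τ (-1) 0 τ (fun σ => by ring)]
      have e1 : stageDefect fourthOrder F Z y τ
          = (∫ σ in (0 : ℝ)..1, (1 / 6 + (τ - σ) / 2) • f σ)
            - ∫ σ in (0 : ℝ)..τ, (τ - σ) • f σ := rfl
      rw [e1]
      module
    rw [key]
    have r1 : ‖∫ σ in (0 : ℝ)..1, (1 / 6 + (τ - σ) / 2) •
        (f σ - (1 : ℝ) • G₀ - (((τ - σ) / 2) • Z G₀ + σ • G₁))‖ ≤ K * η ^ 2 := by
      refine norm_integral_unit_le fun σ hσ => ?_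
      rw [norm_smul, Real.norm_eq_abs]
      refine (mul_le_of_le_one_left (norm_nonneg _) (abs_le.2 ⟨?_, ?_⟩)).trans (hrem σ hσ)
      · linarith [hτ.1, hσ.2]
      · linarith [hτ.2, hσ.1]
    have r2 : ‖∫ σ in (0 : ℝ)..τ, (τ - σ) •
        (f σ - (1 : ℝ) • G₀ - (((τ - σ) / 2) • Z G₀ + σ • G₁))‖ ≤ K * η ^ 2 := by
      have := intervalIntegral.norm_integral_le_of_norm_le_const (a := (0 : ℝ)) (b := τ)
        (f := fun σ => (τ - σ) • (f σ - (1 : ℝ) • G₀ - (((τ - σ) / 2) • Z G₀ + σ • G₁)))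
        (C := K * η ^ 2) fun σ hσ => by
          rw [Set.uIoc_of_le hτ.1] at hσ
          rw [norm_smul, Real.norm_eq_abs]
          refine (mul_le_of_le_one_left (norm_nonneg _) (abs_le.2 ⟨?_, ?_⟩)).trans
            (hrem σ ⟨hσ.1.le, hσ.2.trans hτ.2⟩)
          · linarith [hσ.2]
          · linarith [hσ.1, hτ.2]
      rw [sub_zero, abs_of_nonneg hτ.1] at this
      exact this.trans (mul_le_of_le_one_right (by positivity) hτ.2)
    calc _ ≤ K * η ^ 2 + K * η ^ 2 := (norm_sub_le _ _).trans (add_le_add r1 r2)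
      _ = _ := by ring

end FourthOrderDefect

/-! ### Order conditions and the fourth-order local error -/

section FourthOrderStep

/-- The constant of the quadrature remainder in the fourth-order error estimate. -/
noncomputable def remainderConst (k N : ℝ) : ℝ :=
  k ^ 2 * (k * (2 * (k ^ 2 * k * (3 + 2 * N + N ^ 2))) * (3 + 2 * N + N ^ 2))
    * (3 + 2 * N + N ^ 2)

/-- The constant of the error recursion of the fourth-order method. -/
noncomputable def fourthOrderConst (k N L Γ : ℝ) : ℝ :=
  1 + 4 * L + 2 * (4 * L ^ 2 * Γ + 4 * k * Γ ^ 2) + remainderConst k N * (2 + N)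

theorem remainderConst_nonneg {k N : ℝ} (hk : 0 ≤ k) (hN : 0 ≤ N) : 0 ≤ remainderConst k N := by
  unfold remainderConst; positivity

theorem fourthOrderConst_nonneg {k N L Γ : ℝ} (hk : 0 ≤ k) (hN : 0 ≤ N) (hL : 0 ≤ L)
    (hΓ : 0 ≤ Γ) : 0 ≤ fourthOrderConst k N L Γ := by
  have := remainderConst_nonneg hk hN
  unfold fourthOrderConst; positivity

variable {E : Type*} [NormedAddCommGroup E] [NormedSpace ℝ E]

theorem norm_integral_le_of_norm_sub_le {f q : ℝ → E} {K : ℝ}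
    (hf : ContinuousOn f (Set.Icc 0 1)) (hq : Continuous q) (hq0 : ∫ τ in (0 : ℝ)..1, q τ = 0)
    (hfq : ∀ τ ∈ Set.Icc (0 : ℝ) 1, ‖f τ - q τ‖ ≤ K) : ‖∫ τ in (0 : ℝ)..1, f τ‖ ≤ K := by
  have h := norm_integral_unit_le hfq
  rwa [intervalIntegral.integral_sub
    (intervalIntegrable_of_continuousOn_Icc le_rfl zero_le_one le_rfl hf)
    (hq.intervalIntegrable _ _), hq0, sub_zero] at h

variable [CompleteSpace E]

theorem integral_cubic_smul_eq_zero {g : ℝ → ℝ} (c₀ c₁ c₂ c₃ : ℝ) (u : E)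
    (hg : ∀ x, g x = c₀ + c₁ * x + c₂ * x ^ 2 + c₃ * x ^ 3)
    (h0 : c₀ + c₁ / 2 + c₂ / 3 + c₃ / 4 = 0) : ∫ x in (0 : ℝ)..1, g x • u = 0 := by
  rw [intervalIntegral.integral_smul_const, integral_eq_of_eq_cubic c₀ c₁ c₂ c₃ 1 hg]
  simp [h0]

/-- The order conditions of the fourth-order method for the velocity update. -/
theorem integral_velocity_conditions (A₀ A₁ Z : E →L[ℝ] E) (G₀ G₁ : E) :
    ∫ τ in (0 : ℝ)..1, (A₀ ((-1 / 12 + τ / 2 - τ ^ 2 / 2) • G₀)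
      + (A₀ ((1 / 24 - τ / 6 + τ ^ 2 / 4 - τ ^ 3 / 6) • Z G₀
          + (-1 / 12 + τ / 4 - τ ^ 3 / 6) • G₁)
        + (τ • A₁) ((-1 / 12 + τ / 2 - τ ^ 2 / 2) • G₀)
        + ((1 - τ) • Z) (A₀ ((-1 / 12 + τ / 2 - τ ^ 2 / 2) • G₀)))) = 0 := by
  have e : ∀ τ : ℝ, (A₀ ((-1 / 12 + τ / 2 - τ ^ 2 / 2) • G₀)
      + (A₀ ((1 / 24 - τ / 6 + τ ^ 2 / 4 - τ ^ 3 / 6) • Z G₀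
          + (-1 / 12 + τ / 4 - τ ^ 3 / 6) • G₁)
        + (τ • A₁) ((-1 / 12 + τ / 2 - τ ^ 2 / 2) • G₀)
        + ((1 - τ) • Z) (A₀ ((-1 / 12 + τ / 2 - τ ^ 2 / 2) • G₀))))
      = (-1 / 12 + τ / 2 - τ ^ 2 / 2) • A₀ G₀
        + (1 / 24 - τ / 6 + τ ^ 2 / 4 - τ ^ 3 / 6) • A₀ (Z G₀)
        + (-1 / 12 + τ / 4 - τ ^ 3 / 6) • A₀ G₁
        + (τ * (-1 / 12 + τ / 2 - τ ^ 2 / 2)) • A₁ G₀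
        + ((1 - τ) * (-1 / 12 + τ / 2 - τ ^ 2 / 2)) • Z (A₀ G₀) := by
    intro τ
    simp only [map_add, map_smul, smul_apply]
    module
  have hi : ∀ (g : ℝ → ℝ) (u : E), Continuous g →
      IntervalIntegrable (fun τ => g τ • u) MeasureTheory.volume 0 1 := fun g u hg =>
    (hg.smul continuous_const).intervalIntegrable _ _
  simp_rw [e]
  have i1 := hi (fun τ => -1 / 12 + τ / 2 - τ ^ 2 / 2) (A₀ G₀) (by fun_prop)
  have i2 := hi (fun τ => 1 / 24 - τ / 6 + τ ^ 2 / 4 - τ ^ 3 / 6) (A₀ (Z G₀)) (by fun_prop)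
  have i3 := hi (fun τ => -1 / 12 + τ / 4 - τ ^ 3 / 6) (A₀ G₁) (by fun_prop)
  have i4 := hi (fun τ => τ * (-1 / 12 + τ / 2 - τ ^ 2 / 2)) (A₁ G₀) (by fun_prop)
  have i5 := hi (fun τ => (1 - τ) * (-1 / 12 + τ / 2 - τ ^ 2 / 2)) (Z (A₀ G₀)) (by fun_prop)
  -- Five scalar polynomials must have zero mean. The polynomial `-1/12 + τ/2 - τ²/2` is symmetric
  -- about `1/2` with mean zero, so its products with `τ` and `1 - τ` have mean zero as well. The
  -- factor of `Z G₀` is `((1-τ)⁴ - τ⁴)/24`, antisymmetric about `1/2`.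
  rw [intervalIntegral.integral_add (((i1.add i2).add i3).add i4) i5,
    intervalIntegral.integral_add ((i1.add i2).add i3) i4,
    intervalIntegral.integral_add (i1.add i2) i3, intervalIntegral.integral_add i1 i2,
    integral_cubic_smul_eq_zero (-1 / 12) (1 / 2) (-1 / 2) 0 _ (fun x => by ring) (by norm_num),
    integral_cubic_smul_eq_zero (1 / 24) (-1 / 6) (1 / 4) (-1 / 6) _ (fun x => by ring)
      (by norm_num),
    integral_cubic_smul_eq_zero (-1 / 12) (1 / 4) 0 (-1 / 6) _ (fun x => by ring) (by norm_num),
    integral_cubic_smul_eq_zero 0 (-1 / 12) (1 / 2) (-1 / 2) _ (fun x => by ring) (by norm_num),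
    integral_cubic_smul_eq_zero (-1 / 12) (7 / 12) (-1) (1 / 2) _ (fun x => by ring)
      (by norm_num)]
  simp

/-- The order condition of the fourth-order method for the position update. -/
theorem integral_position_condition (A₀ : E →L[ℝ] E) (G₀ : E) :
    ∫ τ in (0 : ℝ)..1,
      ((1 - τ) • (1 : E →L[ℝ] E)) (A₀ ((-1 / 12 + τ / 2 - τ ^ 2 / 2) • G₀)) = 0 := by
  have e : ∀ τ : ℝ, ((1 - τ) • (1 : E →L[ℝ] E)) (A₀ ((-1 / 12 + τ / 2 - τ ^ 2 / 2) • G₀))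
      = ((1 - τ) * (-1 / 12 + τ / 2 - τ ^ 2 / 2)) • A₀ G₀ := by
    intro τ
    simp only [map_smul, smul_apply, one_apply_eq_self]
    module
  simp_rw [e]
  exact integral_cubic_smul_eq_zero (-1 / 12) (7 / 12) (-1) (1 / 2) _ (fun x => by ring)
    (by norm_num)

variable {F : E → E} {M : E →L[ℝ] E} {h Γ : ℝ} {L : ℝ≥0} {R : ℝ≥0∞}
  {x v x' v' : E} {X y w : ℝ → E} {k η N : ℝ} {G₀ G₁ : E} {A : ℝ → E →L[ℝ] E} {A₀ A₁ : E →L[ℝ] E}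

/-- Linearisation of `F` at the exact solution, along the stages. -/
theorem IsStep.norm_linearisation_le {c : Coeffs E} (hst : IsStep c F M h x v X x' v')
    (hZ : ∀ s : ℝ, ‖NormedSpace.exp (s • h • M)‖ ≤ 1) (hc : c.IsAdmissible (h • M))
    (hs : IsLocalSolution F (h • M) h y w) (hR : 0 < R)
    (hL : ∀ τ ∈ Set.Icc (0 : ℝ) 1, LipschitzOnWith L F (Metric.eball (y τ) R))
    (hX : ∀ τ ∈ Set.Icc (0 : ℝ) 1, X τ ∈ Metric.eball (y τ) R)
    (hΓ : ∀ τ ∈ Set.Icc (0 : ℝ) 1, ‖F (y τ)‖ ≤ Γ) (hh : 0 ≤ h) (hh1 : h ≤ 1)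
    (hhL : h ^ 2 * L ≤ 1 / 2) (hk : 0 ≤ k)
    (hquad : ∀ τ ∈ Set.Icc (0 : ℝ) 1, ∀ z, ‖z - y τ‖ ≤ 2 * Γ * h ^ 2 →
      z ∈ Metric.eball (y τ) R ∧ ‖F z - F (y τ) - A τ (z - y τ)‖ ≤ k * ‖z - y τ‖ ^ 2)
    {τ : ℝ} (hτ : τ ∈ Set.Icc (0 : ℝ) 1) :
    ‖F (X τ) - F (y τ) - h ^ 2 • A τ (stageDefect c F (h • M) y τ)‖
      ≤ 2 * L * (‖x - y 0‖ + ‖v - w 0‖) + (4 * L ^ 2 * Γ + 4 * k * Γ ^ 2) * h ^ 4 := by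
  have hFX := continuousOn_comp_of_strip hL hX hst.cont
  have hΓ0 : 0 ≤ Γ := (norm_nonneg _).trans (hΓ 0 (by simp))
  have hL0 : (0 : ℝ) ≤ L := L.2
  set D := stageDefect c F (h • M) y τ with hD
  have hDn : ‖D‖ ≤ 2 * Γ := norm_stageDefect_le hZ hc hτ hΓ
  -- `W` is the stage obtained by inserting the exact solution in the right side. It differs from `X
  -- τ` by incoming errors and `O(h⁴)`, and from `y τ` by `O(h²)`, so Taylor at `y τ` costs `O(h⁴)`.
  set W := y τ + h ^ 2 • D with hW
  have hWy : W - y τ = h ^ 2 • D := by rw [hW]; abel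
  have hWn : ‖W - y τ‖ ≤ 2 * Γ * h ^ 2 := by
    rw [hWy, norm_smul, Real.norm_eq_abs, abs_of_nonneg (sq_nonneg h)]
    nlinarith [sq_nonneg h]
  obtain ⟨hWmem, hWq⟩ := hquad τ hτ W hWn
  set s := ‖x - y 0‖ with hs_def
  set r := ‖v - w 0‖ with hr_def
  have hS : ∀ σ ∈ Set.Icc (0 : ℝ) 1, ‖F (X σ) - F (y σ)‖ ≤ L * (2 * (s + r + 2 * Γ * h ^ 2)) := by
    intro σ hσ
    have h1 := hst.norm_stage_sub_le hZ hc hs hR hL hX hΓ hh hhL hσ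
    refine (norm_sub_le_of_strip hR hL hX hσ).trans (mul_le_mul_of_nonneg_left (h1.trans ?_) hL0)
    have : h * r ≤ r := mul_le_of_le_one_left (norm_nonneg _) hh1
    linarith
  have hXW : ‖X τ - W‖ ≤ 2 * (s + r) + 4 * L * Γ * h ^ 4 := by
    have e : X τ - W = (x - y 0) + h • psi (h • M) τ (v - w 0)
        + h ^ 2 • (∫ σ in (0 : ℝ)..1, c.α τ σ (h • M) (F (X σ) - F (y σ))) := by
      have := hst.stage_sub hc hs hFX hτ
      rw [hW, ← sub_sub, this]
      abel
    have h3 : ‖psi (h • M) τ (v - w 0)‖ ≤ r :=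
      (ContinuousLinearMap.le_opNorm _ _).trans (mul_le_of_le_one_left (norm_nonneg _)
        ((norm_psi_le hZ _).trans (abs_le.2 ⟨by linarith [hτ.1], hτ.2⟩)))
    have h4 := norm_integral_α_le hc hτ hS
    rw [e]
    refine norm_add₃_le.trans ?_
    simp only [norm_smul, Real.norm_eq_abs, abs_of_nonneg hh, abs_of_nonneg (sq_nonneg h)]
    have h5 : h * ‖psi (h • M) τ (v - w 0)‖ ≤ r := by
      calc _ ≤ 1 * r := by gcongr
        _ = r := one_mul r
    have h6 : h ^ 2 * ‖∫ σ in (0 : ℝ)..1, c.α τ σ (h • M) (F (X σ) - F (y σ))‖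
        ≤ h ^ 2 * (L * (2 * (s + r + 2 * Γ * h ^ 2))) := by gcongr
    have hsr : 0 ≤ s + r := add_nonneg (norm_nonneg _) (norm_nonneg _)
    have h7 : h ^ 2 * L * (s + r) ≤ 1 / 2 * (s + r) := mul_le_mul_of_nonneg_right hhL hsr
    linarith
  have hFW : ‖F (X τ) - F W‖ ≤ L * ‖X τ - W‖ := (hL τ hτ).norm_sub_le (hX τ hτ) hWmem
  have e : F (X τ) - F (y τ) - h ^ 2 • A τ D
      = (F (X τ) - F W) + (F W - F (y τ) - A τ (W - y τ)) := by
    rw [hWy, map_smul]; abel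
  have h8 : ‖W - y τ‖ ^ 2 ≤ (2 * Γ * h ^ 2) ^ 2 := by gcongr
  rw [e]
  calc _ ≤ L * (2 * (s + r) + 4 * L * Γ * h ^ 4) + k * (2 * Γ * h ^ 2) ^ 2 :=
        (norm_add_le _ _).trans (add_le_add
          (hFW.trans (mul_le_mul_of_nonneg_left hXW hL0))
          (hWq.trans (mul_le_mul_of_nonneg_left h8 hk)))
    _ = _ := by ring

theorem IsStep.norm_error_le_of_fourthOrder (hst : IsStep fourthOrder F M h x v X x' v')
    (hZ : ∀ s : ℝ, ‖NormedSpace.exp (s • h • M)‖ ≤ 1)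
    (hs : IsLocalSolution F (h • M) h y w) (hR : 0 < R)
    (hL : ∀ τ ∈ Set.Icc (0 : ℝ) 1, LipschitzOnWith L F (Metric.eball (y τ) R))
    (hX : ∀ τ ∈ Set.Icc (0 : ℝ) 1, X τ ∈ Metric.eball (y τ) R)
    (hΓ : ∀ τ ∈ Set.Icc (0 : ℝ) 1, ‖F (y τ)‖ ≤ Γ) (hh : 0 ≤ h) (hh1 : h ≤ 1)
    (hhL : h ^ 2 * L ≤ 1 / 2) (hk : 1 ≤ k) (hhη : h ≤ η) (hN : η ≤ N)
    (hZk : ‖h • M‖ ≤ k * η)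
    (hquad : ∀ τ ∈ Set.Icc (0 : ℝ) 1, ∀ z, ‖z - y τ‖ ≤ 2 * Γ * h ^ 2 →
      z ∈ Metric.eball (y τ) R ∧ ‖F z - F (y τ) - A τ (z - y τ)‖ ≤ k * ‖z - y τ‖ ^ 2)
    (hG : IsExpansion k η (fun τ => F (y τ)) (fun _ => G₀) (fun τ => τ • G₁))
    (hA : IsExpansion k η A (fun _ => A₀) (fun τ => τ • A₁)) :
    ‖x' - y 1‖ + ‖v' - w 1‖
      ≤ (1 + fourthOrderConst k N L Γ * h) * (‖x - y 0‖ + ‖v - w 0‖)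
        + fourthOrderConst k N L Γ * h * (h ^ 2 * η ^ 2) := by
  have hc := fourthOrder_isAdmissible hZ
  have hFX := continuousOn_comp_of_strip hL hX hst.cont
  have hΓ0 : 0 ≤ Γ := (norm_nonneg _).trans (hΓ 0 (by simp))
  have hL0 : (0 : ℝ) ≤ L := L.2
  have hη : 0 ≤ η := hh.trans hhη
  have hN0 : 0 ≤ N := hη.trans hN
  have hk0 : 0 ≤ k := zero_le_one.trans hk
  have hlin := fun τ hτ =>
    hst.norm_linearisation_le hZ hc hs hR hL hX hΓ hh hh1 hhL hk0 hquad (τ := τ) hτ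
  set K₁ := 4 * (L : ℝ) ^ 2 * Γ + 4 * k * Γ ^ 2 with hK₁
  have hK₁0 : 0 ≤ K₁ := by positivity
  set s := ‖x - y 0‖ with hs_def
  set r := ‖v - w 0‖ with hr_def
  have hs0 : 0 ≤ s := norm_nonneg _
  have hr0 : 0 ≤ r := norm_nonneg _
  have hD := isExpansion_stageDefect hZ hs.cont hk hη hN hZk hG
  have hAD := hA.clm_apply hD hk0 (by positivity) hη hN
  have hE := (isExpansion_exp hZ hk hη hZk).clm_apply hAD (by positivity) (by positivity) hη hN
  have hP := (isExpansion_psi hZ hk hη hZk).clm_apply hAD (by positivity) (by positivity) hη hN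
  rw [← remainderConst] at hE hP
  set K₃ := remainderConst k N with hK₃
  have hK₃0 : 0 ≤ K₃ := remainderConst_nonneg hk0 hN0
  simp only [one_apply_eq_self] at hE
  have hce : Continuous fun σ : ℝ => NormedSpace.exp ((1 - σ) • h • M) :=
    (continuous_exp_smul _).comp (by fun_prop : Continuous fun σ : ℝ => 1 - σ)
  have hcp : Continuous fun σ : ℝ => psi (h • M) (1 - σ) :=
    (continuous_psi _).comp (by fun_prop : Continuous fun σ : ℝ => 1 - σ)
  have hdiff := hFX.sub hs.cont
  have hpsi : ∀ τ ∈ Set.Icc (0 : ℝ) 1, ‖psi (h • M) τ‖ ≤ 1 := fun τ hτ =>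
    (norm_psi_le hZ _).trans (abs_le.2 ⟨by linarith [hτ.1], hτ.2⟩)
  have hIv : ‖∫ τ in (0 : ℝ)..1, NormedSpace.exp ((1 - τ) • h • M) (F (X τ) - F (y τ))‖
      ≤ 2 * L * (s + r) + K₁ * h ^ 4 + h ^ 2 * (K₃ * η ^ 2) := by
    refine norm_integral_le_of_norm_sub_le (hce.continuousOn.clm_apply hdiff)
      (q := fun τ => h ^ 2 • _) (Continuous.const_smul ?_ _)
      (by rw [intervalIntegral.integral_smul,
        integral_velocity_conditions A₀ A₁ (h • M) G₀ G₁, smul_zero]) fun τ hτ => ?_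
    · fun_prop
    · have h1 := hE.sub_le τ hτ
      rw [sub_sub] at h1
      set D := stageDefect fourthOrder F (h • M) y τ
      rw [show ∀ Q : E, NormedSpace.exp ((1 - τ) • h • M) (F (X τ) - F (y τ)) - h ^ 2 • Q
          = NormedSpace.exp ((1 - τ) • h • M) (F (X τ) - F (y τ) - h ^ 2 • A τ D)
            + h ^ 2 • (NormedSpace.exp ((1 - τ) • h • M) (A τ D) - Q) from fun Q => by
        rw [map_sub _ (F (X τ) - F (y τ)), map_smul]; module]
      refine (norm_add_le _ _).trans (add_le_add ?_ ?_)
      · exact (ContinuousLinearMap.le_opNorm _ _).trans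
          ((mul_le_of_le_one_left (norm_nonneg _) (hZ _)).trans (hlin τ hτ))
      · rw [norm_smul, Real.norm_eq_abs, abs_of_nonneg (sq_nonneg h)]
        exact mul_le_mul_of_nonneg_left h1 (sq_nonneg h)
  -- Only the term of order 0 is cancelled here; the update multiplies this integral by `h²` rather
  -- than `h`.
  have hIx : ‖∫ τ in (0 : ℝ)..1, psi (h • M) (1 - τ) (F (X τ) - F (y τ))‖
      ≤ 2 * L * (s + r) + K₁ * h ^ 4 + h ^ 2 * (K₃ * (1 + N) * η) := by
    refine norm_integral_le_of_norm_sub_le (hcp.continuousOn.clm_apply hdiff)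
      (q := fun τ => h ^ 2 • _) (Continuous.const_smul ?_ _)
      (by rw [intervalIntegral.integral_smul,
        integral_position_condition A₀ G₀, smul_zero]) fun τ hτ => ?_
    · fun_prop
    · have h1 := hP.norm_sub_le hK₃0 hη hN hτ
      set D := stageDefect fourthOrder F (h • M) y τ
      rw [show ∀ Q : E, psi (h • M) (1 - τ) (F (X τ) - F (y τ)) - h ^ 2 • Q
          = psi (h • M) (1 - τ) (F (X τ) - F (y τ) - h ^ 2 • A τ D)
            + h ^ 2 • (psi (h • M) (1 - τ) (A τ D) - Q) from fun Q => by
        rw [map_sub _ (F (X τ) - F (y τ)), map_smul]; module]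
      refine (norm_add_le _ _).trans (add_le_add ?_ ?_)
      · exact (ContinuousLinearMap.le_opNorm _ _).trans
          ((mul_le_of_le_one_left (norm_nonneg _)
            (hpsi _ ⟨by linarith [hτ.2], by linarith [hτ.1]⟩)).trans (hlin τ hτ))
      · rw [norm_smul, Real.norm_eq_abs, abs_of_nonneg (sq_nonneg h)]
        exact mul_le_mul_of_nonneg_left h1 (sq_nonneg h)
  have hx : ‖x' - y 1‖ ≤ s + h * r + h ^ 2 * (2 * L * (s + r) + K₁ * h ^ 4
      + h ^ 2 * (K₃ * (1 + N) * η)) := by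
    rw [hst.x_sub hc hs hFX]
    refine norm_add₃_le.trans ?_
    simp only [norm_smul, Real.norm_eq_abs, abs_of_nonneg hh, abs_of_nonneg (sq_nonneg h)]
    gcongr
    exact (ContinuousLinearMap.le_opNorm _ _).trans
      (mul_le_of_le_one_left (norm_nonneg _) (hpsi 1 (by simp)))
  have hv : ‖v' - w 1‖ ≤ r + h * (2 * L * (s + r) + K₁ * h ^ 4 + h ^ 2 * (K₃ * η ^ 2)) := by
    rw [hst.v_sub hc hs hFX]
    refine (norm_add_le _ _).trans ?_
    simp only [norm_smul, Real.norm_eq_abs, abs_of_nonneg hh]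
    gcongr
    have := hZ 1
    rw [one_smul] at this
    exact (ContinuousLinearMap.le_opNorm _ _).trans (mul_le_of_le_one_left (norm_nonneg _) this)
  have hh2 : h ^ 2 ≤ h := by nlinarith
  have h4 : h ^ 4 ≤ h ^ 2 * η ^ 2 := by
    calc h ^ 4 = h ^ 2 * h ^ 2 := by ring
      _ ≤ _ := by gcongr
  have q1 : h ^ 2 * (2 * L * (s + r) + K₁ * h ^ 4)
      ≤ h * (2 * L * (s + r) + K₁ * (h ^ 2 * η ^ 2)) := by
    gcongr
  have q2 : h * (K₁ * h ^ 4) ≤ h * (K₁ * (h ^ 2 * η ^ 2)) := by gcongr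
  -- The extra `h` of the position update is traded for the missing `η`.
  have q3 : h ^ 2 * (h ^ 2 * (K₃ * (1 + N) * η)) ≤ h * (h ^ 2 * η ^ 2) * (K₃ * (1 + N)) := by
    calc _ = h * (h ^ 2 * (h * η)) * (K₃ * (1 + N)) := by ring
      _ ≤ h * (h ^ 2 * (η * η)) * (K₃ * (1 + N)) := by gcongr
      _ = _ := by ring
  have q4 : 0 ≤ (2 * K₁ + K₃ * (2 + N)) * (h * (s + r)) := by positivity
  have q5 : 0 ≤ (1 + 4 * L) * (h * (h ^ 2 * η ^ 2)) := by positivity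
  have q6 : 0 ≤ h * s := by positivity
  have ek : fourthOrderConst k N L Γ = (1 + 4 * L) + (2 * K₁ + K₃ * (2 + N)) := by
    rw [fourthOrderConst, hK₁, hK₃]; ring
  rw [ek]
  linarith

end FourthOrderStep

/-! ### Derivatives in the strip and Taylor estimates -/

section Regularity

variable {E G : Type*} [NormedAddCommGroup E] [NormedSpace ℝ E] [NormedAddCommGroup G]
  [NormedSpace ℝ G] {F : E → E} {k : ℕ} {L : ℝ≥0} {D T t : ℝ} {R : ℝ≥0∞} {x : ℝ → E} {z : E}

theorem RegularAlong.contDiffAt (hF : RegularAlong F k L D R T x) (ht : t ∈ Set.Icc 0 T)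
    (hz : z ∈ Metric.eball (x t) R) : ContDiffAt ℝ k F z :=
  (hF.contDiff t ht).contDiffAt (Metric.isOpen_eball.mem_nhds hz)

theorem RegularAlong.hasFDerivAt (hF : RegularAlong F k L D R T x) (hk : 1 ≤ k)
    (ht : t ∈ Set.Icc 0 T) (hz : z ∈ Metric.eball (x t) R) :
    HasFDerivAt F (fderiv ℝ F z) z :=
  ((hF.contDiffAt ht hz).differentiableAt (by exact_mod_cast (by omega : k ≠ 0))).hasFDerivAt

theorem RegularAlong.norm_fderiv_le (hF : RegularAlong F k L D R T x) (hk : 1 ≤ k)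
    (ht : t ∈ Set.Icc 0 T) (hz : z ∈ Metric.eball (x t) R) : ‖fderiv ℝ F z‖ ≤ D := by
  have h := hF.bound t ht z hz 1 (Finset.mem_Icc.2 ⟨le_rfl, hk⟩)
  rwa [← norm_iteratedFDeriv_fderiv, norm_iteratedFDeriv_zero] at h

theorem RegularAlong.contDiffAt_fderiv (hF : RegularAlong F k L D R T x) (hk : 1 ≤ k)
    (ht : t ∈ Set.Icc 0 T) (hz : z ∈ Metric.eball (x t) R) :
    ContDiffAt ℝ ((k - 1 : ℕ) : WithTop ℕ∞) (fderiv ℝ F) z :=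
  (hF.contDiffAt ht hz).fderiv_right (by exact_mod_cast (by omega : k - 1 + 1 ≤ k))

theorem RegularAlong.hasFDerivAt_fderiv (hF : RegularAlong F k L D R T x) (hk : 2 ≤ k)
    (ht : t ∈ Set.Icc 0 T) (hz : z ∈ Metric.eball (x t) R) :
    HasFDerivAt (fderiv ℝ F) (fderiv ℝ (fderiv ℝ F) z) z :=
  ((hF.contDiffAt_fderiv (by omega) ht hz).differentiableAt
    (by exact_mod_cast (by omega : k - 1 ≠ 0))).hasFDerivAt

theorem RegularAlong.norm_fderiv_fderiv_le (hF : RegularAlong F k L D R T x) (hk : 2 ≤ k)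
    (ht : t ∈ Set.Icc 0 T) (hz : z ∈ Metric.eball (x t) R) :
    ‖fderiv ℝ (fderiv ℝ F) z‖ ≤ D := by
  have h := hF.bound t ht z hz 2 (Finset.mem_Icc.2 ⟨by norm_num, hk⟩)
  rwa [← norm_iteratedFDeriv_fderiv, ← norm_iteratedFDeriv_fderiv, norm_iteratedFDeriv_zero] at h

theorem RegularAlong.hasFDerivAt_fderiv_fderiv (hF : RegularAlong F k L D R T x) (hk : 3 ≤ k)
    (ht : t ∈ Set.Icc 0 T) (hz : z ∈ Metric.eball (x t) R) :
    HasFDerivAt (fderiv ℝ (fderiv ℝ F)) (fderiv ℝ (fderiv ℝ (fderiv ℝ F)) z) z :=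
  (((hF.contDiffAt_fderiv (by omega) ht hz).fderiv_right (m := ((k - 2 : ℕ) : WithTop ℕ∞))
    (by exact_mod_cast (by omega : k - 2 + 1 ≤ k - 1))).differentiableAt
    (by exact_mod_cast (by omega : k - 2 ≠ 0))).hasFDerivAt

theorem RegularAlong.norm_fderiv_fderiv_fderiv_le (hF : RegularAlong F k L D R T x) (hk : 3 ≤ k)
    (ht : t ∈ Set.Icc 0 T) (hz : z ∈ Metric.eball (x t) R) :
    ‖fderiv ℝ (fderiv ℝ (fderiv ℝ F)) z‖ ≤ D := by
  have h := hF.bound t ht z hz 3 (Finset.mem_Icc.2 ⟨by norm_num, hk⟩)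
  rwa [← norm_iteratedFDeriv_fderiv, ← norm_iteratedFDeriv_fderiv, ← norm_iteratedFDeriv_fderiv,
    norm_iteratedFDeriv_zero] at h

theorem RegularAlong.mono_bound {D' : ℝ} (hF : RegularAlong F k L D R T x) (hD : D ≤ D') :
    RegularAlong F k L D' R T x :=
  ⟨hF.lipschitz, hF.contDiff, fun t ht z hz s hs => (hF.bound t ht z hz s hs).trans hD⟩

/-- The Taylor estimate of order two for a map with bounded second derivative. -/
theorem norm_sub_sub_le_of_norm_fderiv_fderiv_le {f : E → G} {f' : E → E →L[ℝ] G}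
    {f'' : E → E →L[ℝ] E →L[ℝ] G} {r : ℝ} {y : E}
    (hf : ∀ u ∈ Metric.ball y r, HasFDerivAt f (f' u) u)
    (hf' : ∀ u ∈ Metric.ball y r, HasFDerivAt f' (f'' u) u)
    (hf'' : ∀ u ∈ Metric.ball y r, ‖f'' u‖ ≤ D) (hz : z ∈ Metric.ball y r) :
    ‖f z - f y - f' y (z - y)‖ ≤ D * ‖z - y‖ ^ 2 := by
  have hzr : ‖z - y‖ < r := by rwa [← dist_eq_norm]
  have hy : y ∈ Metric.ball y r := Metric.mem_ball_self ((norm_nonneg _).trans_lt hzr)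
  have hD : 0 ≤ D := (norm_nonneg (f'' y)).trans (hf'' y hy)
  have hsub : Metric.closedBall y ‖z - y‖ ⊆ Metric.ball y r :=
    Metric.closedBall_subset_ball hzr
  have h := (convex_closedBall y ‖z - y‖).norm_image_sub_le_of_norm_hasFDerivWithin_le'
    (f := f) (f' := f') (φ := f' y) (C := D * ‖z - y‖) (x := y) (y := z)
    (fun u hu => (hf u (hsub hu)).hasFDerivWithinAt)
    (fun u hu => by
      have h1 := (convex_ball y r).norm_image_sub_le_of_norm_hasFDerivWithin_le
        (fun u hu => (hf' u hu).hasFDerivWithinAt) hf'' hy (hsub hu)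
      refine h1.trans (mul_le_mul_of_nonneg_left ?_ hD)
      rw [← dist_eq_norm]
      exact hu)
    (Metric.mem_closedBall_self (norm_nonneg _)) (by simp [dist_eq_norm])
  exact h.trans_eq (by ring)

/-- First-order expansion of a smooth map along a local solution. -/
theorem isExpansion_comp {g : E → G} {g' : E → E →L[ℝ] G} {g'' : E → E →L[ℝ] E →L[ℝ] G}
    {r K V W h η : ℝ} {y w : ℝ → E}
    (hg : ∀ u ∈ Metric.ball (y 0) r, HasFDerivAt g (g' u) u)
    (hg' : ∀ u ∈ Metric.ball (y 0) r, HasFDerivAt g' (g'' u) u)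
    (hgD : ∀ u ∈ Metric.ball (y 0) r, ‖g' u‖ ≤ D)
    (hgD' : ∀ u ∈ Metric.ball (y 0) r, ‖g'' u‖ ≤ D)
    (hy : ∀ τ ∈ Set.Icc (0 : ℝ) 1, HasDerivWithinAt y (h • w τ) (Set.Icc 0 1) τ)
    (hw : ∀ τ ∈ Set.Icc (0 : ℝ) 1, ‖w τ‖ ≤ V)
    (hw' : ∀ τ ∈ Set.Icc (0 : ℝ) 1, ‖w τ - w 0‖ ≤ W * η)
    (hh : 0 ≤ h) (hhη : h ≤ η) (hhr : h * V < r) (hK : ‖g (y 0)‖ ≤ K) (hKV : D * V ≤ K)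
    (hKW : D * V ^ 2 + D * W ≤ K) :
    IsExpansion K η (fun τ => g (y τ)) (fun _ => g (y 0))
      (fun τ => τ • h • g' (y 0) (w 0)) := by
  have h01 : (0 : ℝ) ∈ Set.Icc (0 : ℝ) 1 := by simp
  have hV : 0 ≤ V := (norm_nonneg _).trans (hw 0 h01)
  have hr : 0 < r := (mul_nonneg hh hV).trans_lt hhr
  have hy0 : y 0 ∈ Metric.ball (y 0) r := Metric.mem_ball_self hr
  have hD : 0 ≤ D := (norm_nonneg _).trans (hgD _ hy0)
  have hη : 0 ≤ η := hh.trans hhη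
  have hyb : ∀ τ ∈ Set.Icc (0 : ℝ) 1, ‖y τ - y 0‖ ≤ h * V := fun τ hτ => by
    have := norm_image_sub_le_of_norm_deriv_le_segment' hy (C := h * V) (fun σ hσ => by
      rw [norm_smul, Real.norm_eq_abs, abs_of_nonneg hh]
      exact mul_le_mul_of_nonneg_left (hw σ (Set.Ico_subset_Icc_self hσ)) hh) τ hτ
    exact this.trans (mul_le_of_le_one_right (mul_nonneg hh hV) (by linarith [hτ.2]))
  have hyr : ∀ τ ∈ Set.Icc (0 : ℝ) 1, y τ ∈ Metric.ball (y 0) r := fun τ hτ => by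
    rw [Metric.mem_ball, dist_eq_norm]
    exact (hyb τ hτ).trans_lt hhr
  refine ⟨fun _ _ => hK, fun τ hτ => ?_, fun τ hτ => ?_⟩
  · rw [norm_smul, norm_smul, Real.norm_eq_abs, Real.norm_eq_abs, abs_of_nonneg hh,
      abs_of_nonneg hτ.1]
    have h1 : ‖g' (y 0) (w 0)‖ ≤ K :=
      ((g' (y 0)).le_opNorm _).trans ((mul_le_mul (hgD _ hy0) (hw 0 h01)
        (norm_nonneg _) hD).trans hKV)
    have hK0 : 0 ≤ K := (norm_nonneg _).trans hK
    calc _ ≤ 1 * (η * K) := by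
          gcongr
          exact hτ.2
      _ = K * η := by ring
  · have hd : ∀ σ ∈ Set.Icc (0 : ℝ) 1,
        HasDerivWithinAt (fun σ => g (y σ) - g (y 0) - σ • h • g' (y 0) (w 0))
          (g' (y σ) (h • w σ) - h • g' (y 0) (w 0)) (Set.Icc 0 1) σ := fun σ hσ => by
      have h1 := ((hg _ (hyr σ hσ)).comp_hasDerivWithinAt σ (hy σ hσ)).sub_const (g (y 0))
      have h2 := (hasDerivWithinAt_id σ (Set.Icc (0 : ℝ) 1)).smul_const (h • g' (y 0) (w 0))
      rw [one_smul] at h2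
      exact h1.sub h2
    have hb : ∀ σ ∈ Set.Ico (0 : ℝ) 1,
        ‖g' (y σ) (h • w σ) - h • g' (y 0) (w 0)‖ ≤ K * η ^ 2 := fun σ hσ' => by
      have hσ := Set.Ico_subset_Icc_self hσ'
      -- The derivative `g'` moves by `O(h)` along `y`, the velocity `w` by `O(η)`; with the outer
      -- factor `h ≤ η` both contributions are `O(η²)`.
      have e : g' (y σ) (h • w σ) - h • g' (y 0) (w 0)
          = h • ((g' (y σ) - g' (y 0)) (w σ) + g' (y 0) (w σ - w 0)) := by
        simp only [map_smul, map_sub, sub_apply]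
        module
      have h1 : ‖g' (y σ) - g' (y 0)‖ ≤ D * (h * V) :=
        ((convex_ball (y 0) r).norm_image_sub_le_of_norm_hasFDerivWithin_le
          (fun u hu => (hg' u hu).hasFDerivWithinAt) hgD' hy0 (hyr σ hσ)).trans
          (mul_le_mul_of_nonneg_left (hyb σ hσ) hD)
      have hW : 0 ≤ W * η := (norm_nonneg _).trans (hw' σ hσ)
      rw [e, norm_smul, Real.norm_eq_abs, abs_of_nonneg hh]
      calc _ ≤ h * (D * (h * V) * V + D * (W * η)) := by
            refine mul_le_mul_of_nonneg_left ((norm_add_le _ _).trans (add_le_add ?_ ?_)) hh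
            · exact ((g' (y σ) - g' (y 0)).le_opNorm _).trans
                (mul_le_mul h1 (hw σ hσ) (norm_nonneg _) (by positivity))
            · exact ((g' (y 0)).le_opNorm _).trans
                (mul_le_mul (hgD _ hy0) (hw' σ hσ) (norm_nonneg _) hD)
        _ ≤ η * (D * (η * V) * V + D * (W * η)) := by gcongr
        _ = (D * V ^ 2 + D * W) * η ^ 2 := by ring
        _ ≤ _ := by gcongr
    have h3 := norm_image_sub_le_of_norm_deriv_le_segment' hd hb τ hτ
    simp only [sub_self, zero_smul, sub_zero] at h3
    have hKη : 0 ≤ K * η ^ 2 := mul_nonneg ((norm_nonneg _).trans hK) (sq_nonneg η)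
    exact h3.trans (mul_le_of_le_one_right hKη hτ.2)

end Regularity

/-! ### A priori bounds, existence and the uniform global error -/

section GlobalSolutions

variable {E : Type*} [NormedAddCommGroup E] [NormedSpace ℝ E]

/-- A solution of `x' = v`, `v' = M v + F(x)` on `[0, T]` with velocities and forces bounded by
`V`, such that `F` is Lipschitz in a strip along the solution. -/
structure IsBoundedSolution (F : E → E) (M : E →L[ℝ] E) (T V : ℝ) (L : ℝ≥0) (R : ℝ≥0∞)
    (x v : ℝ → E) : Prop where
  deriv_x : ∀ t ∈ Set.Icc 0 T, HasDerivWithinAt x (v t) (Set.Icc 0 T) t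
  deriv_v : ∀ t ∈ Set.Icc 0 T, HasDerivWithinAt v (M (v t) + F (x t)) (Set.Icc 0 T) t
  lipschitz : ∀ t ∈ Set.Icc 0 T, LipschitzOnWith L F (Metric.eball (x t) R)
  norm_v : ∀ t ∈ Set.Icc 0 T, ‖v t‖ ≤ V
  norm_F : ∀ t ∈ Set.Icc 0 T, ‖F (x t)‖ ≤ V

variable {F : E → E} {M : E →L[ℝ] E} {T V h D : ℝ} {L : ℝ≥0} {R : ℝ≥0∞} {x v : ℝ → E} {k n : ℕ}

theorem mem_Icc_of_step (hh : 0 ≤ h) (hn : ((n : ℝ) + 1) * h ≤ T) {τ : ℝ}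
    (hτ : τ ∈ Set.Icc (0 : ℝ) 1) : ((n : ℝ) + τ) * h ∈ Set.Icc 0 T :=
  ⟨mul_nonneg (add_nonneg n.cast_nonneg hτ.1) hh,
    (mul_le_mul_of_nonneg_right (by linarith [hτ.2]) hh).trans hn⟩

theorem IsBoundedSolution.isLocalSolution (hs : IsBoundedSolution F M T V L R x v) (hR : 0 < R)
    (hh : 0 ≤ h) (hn : ((n : ℝ) + 1) * h ≤ T) :
    IsLocalSolution F (h • M) h (fun τ => x (((n : ℝ) + τ) * h))
      (fun τ => v (((n : ℝ) + τ) * h)) := by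
  have hmap : Set.MapsTo (fun τ : ℝ => ((n : ℝ) + τ) * h) (Set.Icc 0 1) (Set.Icc 0 T) :=
    fun τ hτ => mem_Icc_of_step hh hn hτ
  have hd : ∀ τ : ℝ, HasDerivWithinAt (fun τ : ℝ => ((n : ℝ) + τ) * h) h (Set.Icc 0 1) τ := by
    intro τ
    have := ((hasDerivAt_id' τ).const_add (n : ℝ)).mul_const h
    rw [one_mul] at this
    exact this.hasDerivWithinAt
  refine ⟨fun τ hτ => ?_, fun τ hτ => ?_, fun τ hτ => ?_⟩
  · exact (hs.deriv_x _ (hmap hτ)).scomp τ (hd τ) hmap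
  · have := (hs.deriv_v _ (hmap hτ)).scomp τ (hd τ) hmap
    rwa [smul_add] at this
  · have h1 : ContinuousAt F (x (((n : ℝ) + τ) * h)) :=
      (hs.lipschitz _ (hmap hτ)).continuousOn.continuousAt
        (Metric.isOpen_eball.mem_nhds (Metric.mem_eball_self hR))
    have h2 := ContinuousWithinAt.comp (f := fun τ : ℝ => ((n : ℝ) + τ) * h) (g := x)
      (hs.deriv_x _ (hmap hτ)).continuousWithinAt (hd τ).continuousWithinAt hmap
    exact ContinuousAt.comp_continuousWithinAt (f := fun τ => x (((n : ℝ) + τ) * h)) h1 h2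

variable [CompleteSpace E]

/-- A priori bound for the exact solution, independent of `M`. -/
theorem RegularAlong.isBoundedSolution (hF : RegularAlong F k L D R T x) (hk : 1 ≤ k)
    (hR : 0 < R) (hD : 0 ≤ D) (hM : ∀ s : ℝ, ‖NormedSpace.exp (s • M)‖ ≤ 1)
    (hx : ∀ t ∈ Set.Icc 0 T, HasDerivWithinAt x (v t) (Set.Icc 0 T) t)
    (hv : ∀ t ∈ Set.Icc 0 T, HasDerivWithinAt v (M (v t) + F (x t)) (Set.Icc 0 T) t)
    {A : ℝ} (hA : 0 ≤ A) (hv0 : ‖v 0‖ ≤ A) (hF0 : ‖F (x 0)‖ ≤ A) :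
    IsBoundedSolution F M T (A * Real.exp ((1 + D) * T)) L R x v := by
  -- Undoing the rotation removes `M` from the equation: `u' = exp (-t M) F(x)`, while `‖v‖ ≤ ‖u‖`.
  set u : ℝ → E := fun t => NormedSpace.exp ((-t) • M) (v t) with hu
  have hvu : ∀ t, ‖v t‖ ≤ ‖u t‖ := fun t => by
    have e : v t = NormedSpace.exp (t • M) (u t) := by
      let _ : NormedAlgebra ℚ (E →L[ℝ] E) := .restrictScalars ℚ ℝ _
      have h1 : NormedSpace.exp (t • M) * NormedSpace.exp ((-t) • M) = 1 := by
        rw [← NormedSpace.exp_add_of_commute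
          (((Commute.refl M).smul_left t).smul_right (-t)), ← add_smul]
        simp
      have := congrArg (fun P : E →L[ℝ] E => P (v t)) h1
      exact this.symm
    rw [e]
    exact (ContinuousLinearMap.le_opNorm _ _).trans
      (mul_le_of_le_one_left (norm_nonneg _) (hM t))
  have hud : ∀ t ∈ Set.Icc 0 T, HasDerivWithinAt u (NormedSpace.exp ((-t) • M) (F (x t)))
      (Set.Icc 0 T) t := fun t ht => by
    have h1 : HasDerivAt (fun t : ℝ => NormedSpace.exp ((-t) • M))
        ((-1 : ℝ) • (NormedSpace.exp ((-t) • M) * M)) t :=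
      (hasDerivAt_exp_smul M (-t)).scomp t (hasDerivAt_id' t).neg
    refine (h1.hasDerivWithinAt.clm_apply (hv t ht)).congr_deriv ?_
    simp
  have hfd : ∀ t ∈ Set.Icc 0 T, HasDerivWithinAt (fun t => F (x t)) (fderiv ℝ F (x t) (v t))
      (Set.Icc 0 T) t := fun t ht =>
    (hF.hasFDerivAt hk ht (Metric.mem_eball_self hR)).comp_hasDerivWithinAt t (hx t ht)
  have hp : ∀ t ∈ Set.Icc 0 T, HasDerivWithinAt (fun t => (u t, F (x t)))
      (NormedSpace.exp ((-t) • M) (F (x t)), fderiv ℝ F (x t) (v t)) (Set.Icc 0 T) t :=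
    fun t ht => (hud t ht).prodMk (hfd t ht)
  have hbound : ∀ t ∈ Set.Icc 0 T, ‖(u t, F (x t))‖ ≤ A * Real.exp ((1 + D) * T) := by
    intro t ht
    -- Gronwall for the pair `(u, F ∘ x)`. Since `(F ∘ x)' = F'(x) v` is bounded by `D ‖u‖`, the
    -- system closes using `F` at the initial point only and its derivative along the solution.
    have h1 := norm_le_gronwallBound_of_norm_deriv_right_le (δ := A) (K := 1 + D) (ε := 0)
      (fun t ht => (hp t ht).continuousWithinAt)
      (fun t ht => (hp t (Set.Ico_subset_Icc_self ht)).mono_of_mem_nhdsWithin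
        (Icc_mem_nhdsGE_of_mem ht))
      (by
        refine max_le ?_ hF0
        simpa [hu] using hv0)
      (fun t ht => by
        have hm : ‖u t‖ ≤ ‖(u t, F (x t))‖ := le_max_left _ _
        have hm' : ‖F (x t)‖ ≤ ‖(u t, F (x t))‖ := le_max_right _ _
        rw [add_zero]
        refine max_le ?_ ?_
        · calc _ ≤ 1 * ‖(u t, F (x t))‖ := (ContinuousLinearMap.le_opNorm _ _).trans
                (mul_le_mul (hM _) hm' (norm_nonneg _) zero_le_one)
            _ ≤ _ := by gcongr; linarith
        · calc _ ≤ D * ‖(u t, F (x t))‖ := (ContinuousLinearMap.le_opNorm _ _).trans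
                (mul_le_mul (hF.norm_fderiv_le hk (Set.Ico_subset_Icc_self ht)
                  (Metric.mem_eball_self hR)) ((hvu t).trans hm) (norm_nonneg _) hD)
            _ ≤ _ := by gcongr; linarith) t ht
    rw [gronwallBound_ε0, sub_zero] at h1
    refine h1.trans ?_
    gcongr
    exact ht.2
  exact ⟨hx, hv, hF.lipschitz, fun t ht => (hvu t).trans ((le_max_left _ _).trans (hbound t ht)),
    fun t ht => (le_max_right _ _).trans (hbound t ht)⟩

variable {c : Coeffs E} {x₀ v₀ : E} {xn vn : ℕ → E} {X : ℕ → ℝ → E}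

theorem IsBoundedSolution.norm_error_le (hs : IsBoundedSolution F M T V L R x v)
    (hM : ∀ s : ℝ, ‖NormedSpace.exp (s • h • M)‖ ≤ 1) (hc : c.IsAdmissible (h • M))
    (hR : 0 < R) (hV : 0 ≤ V) (hh : 0 ≤ h) (hh1 : h ≤ 1) (hhL : h ^ 2 * L ≤ 1 / 2)
    (hn : (n : ℝ) * h ≤ T) (hx0 : xn 0 = x 0) (hv0 : vn 0 = v 0)
    (hstep : ∀ m < n, IsStep c F M h (xn m) (vn m) (X m) (xn (m + 1)) (vn (m + 1)) ∧
      ∀ τ ∈ Set.Icc (0 : ℝ) 1, X m τ ∈ Metric.eball (x (((m : ℝ) + τ) * h)) R) :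
    ‖xn n - x (n * h)‖ + ‖vn n - v (n * h)‖
      ≤ 2 * V * h ^ 2 * Real.exp ((1 + 4 * L) * T) := by
  have hK : (0 : ℝ) ≤ 1 + 4 * L := by positivity
  have key := le_exp_of_recursion (a := fun m => ‖xn m - x (m * h)‖ + ‖vn m - v (m * h)‖)
    (K := 1 + 4 * L) (δ := 2 * V * h ^ 2) (n := n) hK (by positivity) hh (by simp [hx0, hv0])
    (fun m hm => by
      have hmT : ((m : ℝ) + 1) * h ≤ T := by
        have : (m : ℝ) + 1 ≤ n := by exact_mod_cast hm
        exact (mul_le_mul_of_nonneg_right this hh).trans hn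
      obtain ⟨h1, h2⟩ := hstep m hm
      have := h1.norm_error_le hM hc (hs.isLocalSolution hR hh hmT) hR
        (fun τ hτ => hs.lipschitz _ (mem_Icc_of_step hh hmT hτ)) h2
        (fun τ hτ => hs.norm_F _ (mem_Icc_of_step hh hmT hτ)) hh hh1 hhL
      simpa using this)
  refine key.trans ?_
  gcongr

theorem IsBoundedSolution.exists_numericalSolution (hs : IsBoundedSolution F M T V L R x v)
    (hM : ∀ s : ℝ, ‖NormedSpace.exp (s • h • M)‖ ≤ 1) (hc : c.IsAdmissible (h • M))
    (hV : 0 ≤ V) (hh : 0 ≤ h) (hh1 : h ≤ 1) (hhL : h ^ 2 * L ≤ 1 / 2) {r : ℝ} (hr : 0 ≤ r)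
    (hrR : ENNReal.ofReal r < R)
    (hhr : h ^ 2 * (2 * V * Real.exp ((1 + 4 * L) * T) + L * r + 2 * V) ≤ r) :
    ∃ (xn vn : ℕ → E) (X : ℕ → ℝ → E),
      IsNumericalSolution c F M T h (x 0) (v 0) xn vn X ∧ StagesInStrip R T h x X := by
  have hR : 0 < R := pos_of_gt hrR
  refine CPD.exists_numericalSolution hh fun n hn xn vn X hx0 hv0 hstep => ?_
  have hn' : (n : ℝ) * h ≤ T := by linarith
  have he := hs.norm_error_le hM hc hR hV hh hh1 hhL hn' hx0 hv0 hstep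
  refine exists_isStep (ρ := r) hM hc (hs.isLocalSolution hR hh hn)
    (fun τ hτ => hs.lipschitz _ (mem_Icc_of_step hh hn hτ))
    (fun τ hτ => hs.norm_F _ (mem_Icc_of_step hh hn hτ)) hh hhL hr hrR ?_
  simp only [add_zero]
  have h1 : h * ‖vn n - v (n * h)‖ ≤ ‖vn n - v (n * h)‖ :=
    mul_le_of_le_one_left (norm_nonneg _) hh1
  linarith

end GlobalSolutions

/-! ### Global error of the fourth-order method -/

section FourthOrderGlobal

variable {E : Type*} [NormedAddCommGroup E] [NormedSpace ℝ E] {F : E → E} {M : E →L[ℝ] E}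
  {T V h b D N r η : ℝ} {L : ℝ≥0} {R : ℝ≥0∞} {x v : ℝ → E} {n : ℕ} {x₀ v₀ : E}
  {xn vn : ℕ → E} {X : ℕ → ℝ → E}

/-- The size of the expansions of `F` and of its derivative along the exact solution. -/
noncomputable def expansionConst (b V D : ℝ) : ℝ :=
  1 + b + V + D + D * V + D * V ^ 2 + D * (b * V + V)

/-- In rescaled time `w' = Z w + h F(y)`, where the rotation part is `O(η)`; the velocity varies by
`O(η)`, not `O(h)`. This is why expansions are taken in `η`. -/
theorem IsLocalSolution.norm_w_sub_le {Z : E →L[ℝ] E} {y w : ℝ → E}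
    (hs : IsLocalSolution F Z h y w)
    (hw : ∀ τ ∈ Set.Icc (0 : ℝ) 1, ‖w τ‖ ≤ V) (hF : ∀ τ ∈ Set.Icc (0 : ℝ) 1, ‖F (y τ)‖ ≤ V)
    (hh : 0 ≤ h) (hhη : h ≤ η) (hb : 0 ≤ b) (hZ : ‖Z‖ ≤ b * η) {τ : ℝ}
    (hτ : τ ∈ Set.Icc (0 : ℝ) 1) : ‖w τ - w 0‖ ≤ (b * V + V) * η := by
  have hV : 0 ≤ V := (norm_nonneg _).trans (hw τ hτ)
  have hη : 0 ≤ η := hh.trans hhη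
  have := norm_image_sub_le_of_norm_deriv_le_segment' hs.deriv_w (C := (b * V + V) * η)
    (fun σ hσ => by
      have hσ' := Set.Ico_subset_Icc_self hσ
      calc _ ≤ ‖Z‖ * ‖w σ‖ + h * ‖F (y σ)‖ := by
            refine (norm_add_le _ _).trans (add_le_add (Z.le_opNorm _) ?_)
            rw [norm_smul, Real.norm_eq_abs, abs_of_nonneg hh]
        _ ≤ (b * η) * V + η * V := by
            gcongr
            exacts [hw σ hσ', hF σ hσ']
        _ = _ := by ring) τ hτ
  exact this.trans (mul_le_of_le_one_right (by positivity) (by linarith [hτ.2]))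

variable [CompleteSpace E]

theorem IsBoundedSolution.norm_error_le_of_fourthOrder (hs : IsBoundedSolution F M T V L R x v)
    (hF : RegularAlong F 4 L D R T x) (hM : ∀ s : ℝ, ‖NormedSpace.exp (s • h • M)‖ ≤ 1)
    (hV : 0 ≤ V) (hD : 0 ≤ D) (hb : 0 ≤ b) (hN : η ≤ N)
    (hh : 0 ≤ h) (hh1 : h ≤ 1) (hhL : h ^ 2 * L ≤ 1 / 2) (hhη : h ≤ η)
    (hZ : ‖h • M‖ ≤ b * η) (hr : 0 < r) (hrR : ENNReal.ofReal r < R) (hhr : h * V < r)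
    (hhr' : 2 * V * h ^ 2 < r) (hn : (n : ℝ) * h ≤ T) (hx0 : xn 0 = x 0) (hv0 : vn 0 = v 0)
    (hstep : ∀ m < n, IsStep fourthOrder F M h (xn m) (vn m) (X m) (xn (m + 1)) (vn (m + 1)) ∧
      ∀ τ ∈ Set.Icc (0 : ℝ) 1, X m τ ∈ Metric.eball (x (((m : ℝ) + τ) * h)) R) :
    ‖xn n - x (n * h)‖ + ‖vn n - v (n * h)‖
      ≤ h ^ 2 * η ^ 2 * Real.exp (fourthOrderConst (expansionConst b V D) N L V * T) := by
  have hR : 0 < R := pos_of_gt hrR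
  have hη : 0 ≤ η := hh.trans hhη
  set k := expansionConst b V D with hk_def
  have p1 : 0 ≤ D * V := by positivity
  have p2 : 0 ≤ D * V ^ 2 := by positivity
  have p3 : 0 ≤ D * (b * V + V) := by positivity
  have hk1 : 1 ≤ k := by rw [hk_def, expansionConst]; linarith
  have hkb : b ≤ k := by rw [hk_def, expansionConst]; linarith
  have hkV : V ≤ k := by rw [hk_def, expansionConst]; linarith
  have hkD : D ≤ k := by rw [hk_def, expansionConst]; linarith
  have hkDV : D * V ≤ k := by rw [hk_def, expansionConst]; linarith
  have hkW : D * V ^ 2 + D * (b * V + V) ≤ k := by rw [hk_def, expansionConst]; linarith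
  have hK : 0 ≤ fourthOrderConst k N L V :=
    fourthOrderConst_nonneg (zero_le_one.trans hk1) (hη.trans hN) L.2 hV
  have hsub : ∀ z : E, Metric.ball z r ⊆ Metric.eball z R := fun z u hu => by
    rw [Metric.mem_eball, edist_dist]
    exact ((ENNReal.ofReal_lt_ofReal_iff hr).2 hu).trans hrR
  have key := le_exp_of_recursion (a := fun m => ‖xn m - x (m * h)‖ + ‖vn m - v (m * h)‖)
    (K := fourthOrderConst k N L V) (δ := h ^ 2 * η ^ 2) (n := n) hK (by positivity) hh
    (by simp [hx0, hv0])
    (fun m hm => by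
      have hmT : ((m : ℝ) + 1) * h ≤ T := by
        have : (m : ℝ) + 1 ≤ n := by exact_mod_cast hm
        exact (mul_le_mul_of_nonneg_right this hh).trans hn
      obtain ⟨h1, h2⟩ := hstep m hm
      have hmem := fun τ (hτ : τ ∈ Set.Icc (0 : ℝ) 1) => mem_Icc_of_step hh hmT hτ
      have hloc := hs.isLocalSolution hR hh hmT
      have h0 : (0 : ℝ) ∈ Set.Icc (0 : ℝ) 1 := by simp
      have hw := fun τ hτ => hloc.norm_w_sub_le (fun τ hτ => hs.norm_v _ (hmem τ hτ))
        (fun τ hτ => hs.norm_F _ (hmem τ hτ)) hh hhη hb hZ (τ := τ) hτ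
      have hG := isExpansion_comp (K := k) (r := r)
        (fun u hu => hF.hasFDerivAt (by norm_num) (hmem 0 h0) (hsub _ hu))
        (fun u hu => hF.hasFDerivAt_fderiv (by norm_num) (hmem 0 h0) (hsub _ hu))
        (fun u hu => hF.norm_fderiv_le (by norm_num) (hmem 0 h0) (hsub _ hu))
        (fun u hu => hF.norm_fderiv_fderiv_le (by norm_num) (hmem 0 h0) (hsub _ hu))
        hloc.deriv_y (fun τ hτ => hs.norm_v _ (hmem τ hτ)) hw hh hhη hhr
        ((hs.norm_F _ (hmem 0 h0)).trans hkV) hkDV hkW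
      have hA := isExpansion_comp (K := k) (r := r)
        (fun u hu => hF.hasFDerivAt_fderiv (by norm_num) (hmem 0 h0) (hsub _ hu))
        (fun u hu => hF.hasFDerivAt_fderiv_fderiv (by norm_num) (hmem 0 h0) (hsub _ hu))
        (fun u hu => hF.norm_fderiv_fderiv_le (by norm_num) (hmem 0 h0) (hsub _ hu))
        (fun u hu => hF.norm_fderiv_fderiv_fderiv_le (by norm_num) (hmem 0 h0) (hsub _ hu))
        hloc.deriv_y (fun τ hτ => hs.norm_v _ (hmem τ hτ)) hw hh hhη hhr
        ((hF.norm_fderiv_le (by norm_num) (hmem 0 h0) (Metric.mem_eball_self hR)).trans hkD)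
        hkDV hkW
      have := h1.norm_error_le_of_fourthOrder hM hloc hR
        (fun τ hτ => hs.lipschitz _ (hmem τ hτ)) h2 (fun τ hτ => hs.norm_F _ (hmem τ hτ))
        hh hh1 hhL hk1 hhη hN (hZ.trans (mul_le_mul_of_nonneg_right hkb hη))
        (fun τ hτ z hz => by
          have hzr : z ∈ Metric.ball (x (((m : ℝ) + τ) * h)) r := by
            rw [Metric.mem_ball, dist_eq_norm]; exact hz.trans_lt hhr'
          refine ⟨hsub _ hzr, (norm_sub_sub_le_of_norm_fderiv_fderiv_le
            (fun u hu => hF.hasFDerivAt (by norm_num) (hmem τ hτ) (hsub _ hu))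
            (fun u hu => hF.hasFDerivAt_fderiv (by norm_num) (hmem τ hτ) (hsub _ hu))
            (fun u hu => hF.norm_fderiv_fderiv_le (by norm_num) (hmem τ hτ) (hsub _ hu))
            hzr).trans ?_⟩
          gcongr) hG hA
      simpa using this)
  refine key.trans ?_
  gcongr

end FourthOrderGlobal

/-! ### Skew-adjointness and unitary exponentials -/

section Skew

theorem skewOp_mem_skewAdjoint (B : E3) : skewOp B ∈ skewAdjoint (E3 →L[ℝ] E3) := by
  rw [skewAdjoint.mem_iff, skewOp, ← map_star, ← map_neg]
  congr 1
  ext i j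
  fin_cases i <;> fin_cases j <;> simp [skewMatrix, Matrix.star_apply]

theorem norm_exp_le_one_of_mem_skewAdjoint {S : E3 →L[ℝ] E3}
    (hS : S ∈ skewAdjoint (E3 →L[ℝ] E3)) : ‖NormedSpace.exp S‖ ≤ 1 := by
  let _ : NormedAlgebra ℚ (E3 →L[ℝ] E3) := .restrictScalars ℚ ℝ _
  exact (CStarRing.norm_of_mem_unitary (NormedSpace.exp_mem_unitary_of_mem_skewAdjoint hS)).le

theorem cross_smul (c : ℝ) (u w : E3) : cross u (c • w) = c • cross u w := by
  simp [cross]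

end Skew

end CPD

/-! ### Choice of constants and conclusion -/

theorem mainTheorem3 (B x₀ v₀ : CPD.E3) (T Chat F₀ D : ℝ) (L : ℝ≥0) (R : ℝ≥0∞)
    (hT : 0 < T) (hChat : 0 < Chat) (hR : 0 < R) :
    ∃ h₀ : ℝ, 0 < h₀ ∧ ∃ C : ℝ, 0 < C ∧
      ∀ F : CPD.E3 → CPD.E3, ‖F x₀‖ ≤ F₀ →
      ∀ ε : ℝ, 0 < ε → ε ≤ 1 →
      ∀ h : ℝ, 0 < h → h ≤ h₀ → h ≤ Chat * ε →
      ∀ x v : ℝ → CPD.E3, CPD.IsExactSolution F B ε T x₀ v₀ x v →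
        (CPD.RegularAlong F 2 L D R T x →
          (∃ (xn vn : ℕ → CPD.E3) (X : ℕ → ℝ → CPD.E3),
            CPD.IsNumericalSolution CPD.secondOrder F (ε⁻¹ • CPD.skewOp B) T h x₀ v₀ xn vn X ∧
            CPD.StagesInStrip R T h x X) ∧
          ∀ (xn vn : ℕ → CPD.E3) (X : ℕ → ℝ → CPD.E3),
            CPD.IsNumericalSolution CPD.secondOrder F (ε⁻¹ • CPD.skewOp B) T h x₀ v₀ xn vn X →
            CPD.StagesInStrip R T h x X →
            ∀ n : ℕ, (n : ℝ) * h ≤ T →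
              ‖x (n * h) - xn n‖ ≤ C * h ^ 2 ∧
              ‖v (n * h) - vn n‖ ≤ C * h ^ 2 / ε) ∧
        (CPD.RegularAlong F 4 L D R T x →
          (∃ (xn vn : ℕ → CPD.E3) (X : ℕ → ℝ → CPD.E3),
            CPD.IsNumericalSolution CPD.fourthOrder F (ε⁻¹ • CPD.skewOp B) T h x₀ v₀ xn vn X ∧
            CPD.StagesInStrip R T h x X) ∧
          ∀ (xn vn : ℕ → CPD.E3) (X : ℕ → ℝ → CPD.E3),
            CPD.IsNumericalSolution CPD.fourthOrder F (ε⁻¹ • CPD.skewOp B) T h x₀ v₀ xn vn X →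
            CPD.StagesInStrip R T h x X →
            ∀ n : ℕ, (n : ℝ) * h ≤ T →
              ‖x (n * h) - xn n‖ ≤ C * h ^ 4 / ε ^ 2 ∧
              ‖v (n * h) - vn n‖ ≤ C * h ^ 4 / ε ^ 3) := by

  -- Neither `D` nor `F₀` is assumed nonnegative; absolute values keep the constants nonnegative
  -- before `F` is introduced.
  set D' := |D|
  set A := ‖v₀‖ + |F₀|
  set V := A * Real.exp ((1 + D') * T)
  have hA : 0 ≤ A := by positivity
  have hV : 0 ≤ V := by positivity
  set b := ‖CPD.skewOp B‖
  -- A finite radius inside the strip, needed because `R` may be infinite.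
  obtain ⟨r', hr'0, hr'R⟩ := ENNReal.lt_iff_exists_nnreal_btwn.1 hR
  set r : ℝ := (r' : ℝ)
  have hr : 0 < r := by exact_mod_cast hr'0
  have hrR : ENNReal.ofReal r < R := by rwa [ENNReal.ofReal_coe_nnreal]
  set S := 2 * V * Real.exp ((1 + 4 * L) * T)
  have hS : 0 ≤ S := by positivity
  set P := Real.exp (CPD.fourthOrderConst (CPD.expansionConst b V D') Chat L V * T)
  have hP : 0 ≤ P := by positivity
  have hL : (0 : ℝ) ≤ L := L.2
  -- With `h ≤ 1`, the single condition `h Q ≤ r` yields all radius conditions: solvability of the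
  -- stages, `h V < r` along one step, and `2 V h² < r` for the Taylor estimate. The summand 1 makes
  -- the last two strict.
  set Q := S + L * r + 2 * V + V + 1
  have hQ : 0 < Q := by positivity
  refine ⟨min 1 (min (1 / (2 * L + 1)) (r / Q)), by positivity, 1 + S + P, by positivity, ?_⟩
  intro F hF0 ε hε hε1 h hh hh0 hhε x v hex
  have hh1 : h ≤ 1 := hh0.trans (min_le_left _ _)
  have hh2 : h ^ 2 ≤ h := by nlinarith
  have hhL : h ^ 2 * L ≤ 1 / 2 := by
    have h1 : h ≤ 1 / (2 * L + 1) := hh0.trans ((min_le_right _ _).trans (min_le_left _ _))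
    rw [le_div_iff₀ (by positivity)] at h1
    nlinarith [mul_le_mul_of_nonneg_right hh2 hL]
  have hhQ : h * Q ≤ r := by
    have h1 : h ≤ r / Q := hh0.trans ((min_le_right _ _).trans (min_le_right _ _))
    rwa [le_div_iff₀ hQ] at h1
  have hhr : h * V < r := by
    refine lt_of_lt_of_le (mul_lt_mul_of_pos_left ?_ hh) hhQ
    simp only [Q]
    linarith [mul_nonneg hL hr.le]
  have hhr' : 2 * V * h ^ 2 < r := by
    calc 2 * V * h ^ 2 ≤ h * (2 * V) := by nlinarith
      _ < h * Q := by
          refine mul_lt_mul_of_pos_left ?_ hh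
          simp only [Q]
          linarith [mul_nonneg hL hr.le]
      _ ≤ r := hhQ
  have hhS : h ^ 2 * (S + L * r + 2 * V) ≤ r := by
    refine le_trans (mul_le_mul hh2 ?_ (by positivity) hh.le) hhQ
    simp only [Q]
    linarith
  set η := h / ε
  have hhη : h ≤ η := le_div_self hh.le hε hε1
  -- The only use of `h ≤ Chat * ε`: it bounds `η` in the fourth-order constants.
  have hN : η ≤ Chat := (div_le_iff₀ hε).2 hhε
  set M : CPD.E3 →L[ℝ] CPD.E3 := ε⁻¹ • CPD.skewOp B
  have hMs : ∀ s : ℝ, ‖NormedSpace.exp (s • M)‖ ≤ 1 := fun s =>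
    CPD.norm_exp_le_one_of_mem_skewAdjoint
      (skewAdjoint.smul_mem _ (skewAdjoint.smul_mem _ (CPD.skewOp_mem_skewAdjoint B)))
  have hZ : ∀ s : ℝ, ‖NormedSpace.exp (s • h • M)‖ ≤ 1 := fun s => by
    rw [smul_smul]; exact hMs _
  have hZn : ‖h • M‖ ≤ b * η := by
    rw [norm_smul, norm_smul, Real.norm_eq_abs, Real.norm_eq_abs, abs_of_pos hh,
      abs_of_pos (inv_pos.2 hε)]
    exact le_of_eq (by simp only [η, b]; ring)
  have hbd : ∀ k : ℕ, 1 ≤ k → CPD.RegularAlong F k L D R T x →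
      CPD.RegularAlong F k L D' R T x ∧ CPD.IsBoundedSolution F M T V L R x v := by
    intro k hk hreg
    have hreg' := hreg.mono_bound (le_abs_self D)
    refine ⟨hreg', hreg'.isBoundedSolution hk hR (abs_nonneg D) hMs hex.deriv_x
      (fun t ht => ?_) hA ?_ ?_⟩
    · have e : M (v t) = CPD.cross (v t) (ε⁻¹ • B) := by
        rw [CPD.cross_smul, ← CPD.skewOp_apply]; rfl
      rw [e]
      exact hex.deriv_v t ht
    · rw [hex.init_v]; exact le_add_of_nonneg_right (abs_nonneg _)
    · rw [hex.init_x]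
      exact (hF0.trans (le_abs_self _)).trans (le_add_of_nonneg_left (norm_nonneg _))
  have hprefix : ∀ (c : CPD.Coeffs CPD.E3) (xn vn : ℕ → CPD.E3) (X : ℕ → ℝ → CPD.E3),
      CPD.IsNumericalSolution c F M T h x₀ v₀ xn vn X → CPD.StagesInStrip R T h x X →
      ∀ n : ℕ, (n : ℝ) * h ≤ T → ∀ m < n,
        CPD.IsStep c F M h (xn m) (vn m) (X m) (xn (m + 1)) (vn (m + 1)) ∧
        ∀ τ ∈ Set.Icc (0 : ℝ) 1, X m τ ∈ Metric.eball (x (((m : ℝ) + τ) * h)) R := by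
    intro c xn vn X hnum hstrip n hn m hm
    have hmT : ((m : ℝ) + 1) * h ≤ T := by
      have : (m : ℝ) + 1 ≤ n := by exact_mod_cast hm
      exact (mul_le_mul_of_nonneg_right this hh.le).trans hn
    exact ⟨hnum.step m hmT, hstrip m hmT⟩
  have hx0 := hex.init_x
  have hv0 := hex.init_v
  refine ⟨fun hreg => ?_, fun hreg => ?_⟩
  · obtain ⟨-, hsol⟩ := hbd 2 (by norm_num) hreg
    have hc : CPD.secondOrder.IsAdmissible (h • M) := CPD.secondOrder_isAdmissible hZ
    refine ⟨?_, fun xn vn X hnum hstrip n hn => ?_⟩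
    · have := hsol.exists_numericalSolution hZ hc hV hh.le hh1 hhL hr.le hrR hhS
      rwa [hx0, hv0] at this
    · have key := hsol.norm_error_le hZ hc hR hV hh.le hh1 hhL hn
        (hnum.init_x.trans hx0.symm) (hnum.init_v.trans hv0.symm)
        (hprefix _ xn vn X hnum hstrip n hn)
      have key' : 2 * V * h ^ 2 * Real.exp ((1 + 4 * L) * T) ≤ (1 + S + P) * h ^ 2 := by
        calc _ = S * h ^ 2 := by simp only [S]; ring
          _ ≤ _ := by gcongr; linarith
      rw [norm_sub_rev, norm_sub_rev (v _)]
      refine ⟨by linarith [norm_nonneg (vn n - v (n * h))], ?_⟩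
      -- The velocity error is in fact `O(h²)`; the factor `1/ε ≥ 1` is slack.
      exact le_trans (by linarith [norm_nonneg (xn n - x (n * h))])
        (le_div_self (by positivity) hε hε1)
  · obtain ⟨hreg', hsol⟩ := hbd 4 (by norm_num) hreg
    have hc : CPD.fourthOrder.IsAdmissible (h • M) := CPD.fourthOrder_isAdmissible hZ
    refine ⟨?_, fun xn vn X hnum hstrip n hn => ?_⟩
    · have := hsol.exists_numericalSolution hZ hc hV hh.le hh1 hhL hr.le hrR hhS
      rwa [hx0, hv0] at this
    · have key := hsol.norm_error_le_of_fourthOrder hreg' hZ hV (abs_nonneg D) (norm_nonneg _) hN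
        hh.le hh1 hhL hhη hZn hr hrR hhr hhr' hn
        (hnum.init_x.trans hx0.symm) (hnum.init_v.trans hv0.symm)
        (hprefix _ xn vn X hnum hstrip n hn)
      have key' : h ^ 2 * η ^ 2 * P ≤ (1 + S + P) * h ^ 4 / ε ^ 2 := by
        calc _ = P * h ^ 4 / ε ^ 2 := by simp only [η]; ring
          _ ≤ _ := by gcongr; linarith
      rw [norm_sub_rev, norm_sub_rev (v _)]
      refine ⟨by linarith [norm_nonneg (vn n - v (n * h))], ?_⟩
      refine le_trans (le_trans (by linarith [norm_nonneg (xn n - x (n * h))]) key') ?_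
      -- Here too the velocity satisfies the position bound, and the weaker power of `ε` follows
      -- from `ε ≤ 1`.
      have h3 : ε ^ 3 ≤ ε ^ 2 := pow_le_pow_of_le_one hε.le hε1 (by norm_num)
      gcongr
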